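/- All graphs are finite and simple. For a graph $G$ let $\omega(G)=|E(G)|-|V(G)|+c(G)$ be the dimension of its cycle space, where $c(G)$ is the number of connected components of $G$. Let $\alpha_4(G)$ be the largest cardinality of a set $S\subseteq V(G)$ such that the induced subgraph $G[S]$ contains no tree on $4$ vertices as a (not necessarily induced) subgraph. Let $\Gamma_G$ be the graph obtained from $G$ by deleting all vertices that lie on cycles of $G$. Let $P_4$ and $S_4$ denote the path and the star on $4$ vertices, and define families $R_1,R_2,\dots$ of trees (up to isomorphism) as follows: $R_1=\{P_4,S_4\}$, and for $i\ge 2$ the family $R_i$ consists of all trees obtained from the disjoint union of a member of $R_{i-1}$ and a copy of $P_4$ or $S_4$ by adding one edge joining a vertex of the former to a vertex of the latter; thus every member of $R_i$ has order $4i$. **Theorem.** For every graph $G$ on $n$ vertices, $$\alpha_4(G)\;\ge\;\tfrac34\bigl(n-\omega(G)\bigr),$$ with equality if and only if all of the following conditions hold: (i) the cycles (if any) of $G$ are pairwise vertex-disjoint; (ii) the length of each cycle (if any) of $G$ is congruent to $1$ modulo $4$; (iii) each connected component $T$ of $\Gamma_G$ satisfies $|V(T)|\equiv 0\pmod 4$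 and $T\in R_{|V(T)|/4}$. -/

import Mathlib

namespace SimpleGraph

universe u

variable {V : Type u}

/-- `S` is a generalized `k`-independent set of `G`: the induced subgraph `G[S]` does not contain
a tree with `k` vertices as a (not necessarily induced) subgraph. -/
def IsGenIndepSet (G : SimpleGraph V) (k : ℕ) (S : Finset V) : Prop :=
  ∀ T : SimpleGraph (Fin k), T.IsTree → T.Free (G.induce (S : Set V))

/-- The generalized `k`-independence number `α_k(G)`: the largest cardinality of a generalized
`k`-independent set. -/
noncomputable def genIndepNum (G : SimpleGraph V) (k : ℕ) : ℕ :=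
  sSup {m | ∃ S : Finset V, G.IsGenIndepSet k S ∧ S.card = m}

/-- The dimension of the cycle space of a finite graph, `ω(G) = |E_G| - |V_G| + c(G)`, where
`c(G)` is the number of connected components. -/
noncomputable def cycleSpaceDim (G : SimpleGraph V) : ℤ :=
  (Nat.card G.edgeSet : ℤ) - (Nat.card V : ℤ) + (Nat.card G.ConnectedComponent : ℤ)

/-- The subgraph `C` of `G` is a cycle of `G`: it consists of the vertices and edges traversed by
a closed walk that is a cycle. -/
def IsCycleSubgraph (G : SimpleGraph V) (C : G.Subgraph) : Prop :=
  ∃ (v : V) (p : G.Walk v v), p.IsCycle ∧ p.toSubgraph = C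

/-- The graph `Γ_G`, obtained from `G` by deleting all vertices that lie on cycles of `G`. -/
def deleteCycleVerts (G : SimpleGraph V) :
    SimpleGraph {v : V | ∀ C : G.Subgraph, G.IsCycleSubgraph C → v ∉ C.verts} :=
  G.induce {v : V | ∀ C : G.Subgraph, G.IsCycleSubgraph C → v ∉ C.verts}

/-- The disjoint union of `G` and `H` together with one edge joining `v` (in `G`) to
`w` (in `H`). -/
def joinByEdge {W : Type*} (G : SimpleGraph V) (H : SimpleGraph W) (v : V) (w : W) :
    SimpleGraph (V ⊕ W) :=
  (G ⊕g H) ⊔ edge (Sum.inl v) (Sum.inr w)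

/-- The Li–Zhou families: `LiZhou i G` says that `G` is (isomorphic to) a member of `R_i`.
The members of `R_1` are the path `P_4` and the star `S_4` on four vertices; a member of `R_{i+1}`,
`i ≥ 1`, arises from a member of `R_i` and a copy of `P_4` or of `S_4` by adding an edge between a
vertex of the former and a vertex of the latter. -/
inductive LiZhou : ℕ → {V : Type u} → SimpleGraph V → Prop
  | path {V : Type u} {G : SimpleGraph V} (e : G ≃g pathGraph 4) : LiZhou 1 G
  | star {V : Type u} {G : SimpleGraph V} (e : G ≃g starGraph (0 : Fin 4)) : LiZhou 1 G
  | addPath {V W : Type u} {G : SimpleGraph V} {i : ℕ} {R : SimpleGraph W} (hR : LiZhou i R)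
      (v : W) (w : Fin 4) (e : G ≃g joinByEdge R (pathGraph 4) v w) : LiZhou (i + 1) G
  | addStar {V W : Type u} {G : SimpleGraph V} {i : ℕ} {R : SimpleGraph W} (hR : LiZhou i R)
      (v : W) (w : Fin 4) (e : G ≃g joinByEdge R (starGraph (0 : Fin 4)) v w) : LiZhou (i + 1) G

end SimpleGraph

/-! Having no tree on four vertices in `G[S]` means that no four vertices of `S` induce a connected
subgraph; the proof uses this form (`HasNoConnectedFour`).

Lower bound. Deleting a vertex on a cycle lowers the order by one and `ω` by at least one, so `n -
ω` does not decrease, and it suffices to treat forests. A tree of order at least four has a vertex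
`v` that cuts off a subtree `B ∋ v` with `|B| ≥ 4` in which all branches at `v` have at most three
vertices (`IsConnectedSet.exists_split`). Dropping `v` keeps `|B| - 1 ≥ 3|B|/4` vertices, strictly
more unless `|B| = 4`. Hence a tree attaining equality is built from copies of `P_4` and `S_4`, one
joining edge at a time (`IsAcyclic.exists_hasNoConnectedFour`).

Necessity. Equality (`IsTight`) survives deletion of a vertex on a cycle, and then no vertex
deletion can lower `ω` by more than one. Two different cycles sharing a vertex would violate this.
Deleting cycle vertices in a suitable order isolates each component of `Γ_G` in a forest, where the
tree case identifies it. Deleting the vertices of all cycles but one, and counting modulo 4, gives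
the length of the remaining cycle.

Sufficiency. A set without connected four-sets has at most `3k` vertices on a cycle of length `4k +
1` and at most `3i` in a member of `R_i`. Summing gives `3(n - c)/4`, where `c` is the number of
cycles, and `ω ≤ c` (`cycleSpaceDim_le_ncard_cycleEdgeSets`).

Inductions run over vertex sets `A`, with `G.within A` on the full vertex type: a vertex outside `A`
is isolated there and contributes nothing to `ω`. -/

namespace SimpleGraph

universe u

/-! ### Cycle space dimension under deletion of edges and vertices -/

section CycleSpace

variable {V : Type*} {G H : SimpleGraph V} {v w x y : V}

/-- A vertex lies on a cycle when it is incident with an edge that is not a bridge. -/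
def OnCycle (G : SimpleGraph V) (v : V) : Prop :=
  ∃ w, G.Adj v w ∧ (G.deleteEdges {s(v, w)}).Reachable v w

lemma OnCycle.mono (hGH : G ≤ H) (h : G.OnCycle v) : H.OnCycle v := by
  obtain ⟨w, hw, hr⟩ := h
  exact ⟨w, hGH hw, hr.mono (deleteEdges_mono hGH)⟩

lemma onCycle_iff_exists_isCycle :
    G.OnCycle v ↔ ∃ (u : V) (p : G.Walk u u), p.IsCycle ∧ v ∈ p.support := by
  constructor
  · rintro ⟨w, hw⟩
    obtain ⟨u, p, hp, he⟩ := adj_and_reachable_delete_edges_iff_exists_cycle.1 hw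
    exact ⟨u, p, hp, p.fst_mem_support_of_mem_edges he⟩
  · rintro ⟨u, p, hp, hv⟩
    obtain ⟨e, he, hve⟩ := (Walk.mem_support_iff_exists_mem_edges_of_not_nil hp.not_nil).1 hv
    obtain ⟨w, rfl⟩ := Sym2.mem_iff_exists.1 hve
    exact ⟨w, adj_and_reachable_delete_edges_iff_exists_cycle.2 ⟨u, p, hp, he⟩⟩

lemma isAcyclic_iff_forall_not_onCycle : G.IsAcyclic ↔ ∀ v, ¬ G.OnCycle v := by
  constructor
  · intro h v hv
    obtain ⟨u, p, hp, -⟩ := onCycle_iff_exists_isCycle.1 hv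
    exact h p hp
  · intro h v p hp
    exact h v (onCycle_iff_exists_isCycle.2 ⟨v, p, hp, p.start_mem_support⟩)

lemma Reachable.deleteEdges_singleton_or (v w : V) (h : G.Reachable x y) :
    (G.deleteEdges {s(v, w)}).Reachable x y ∨
      ((G.deleteEdges {s(v, w)}).Reachable x v ∧ (G.deleteEdges {s(v, w)}).Reachable w y) ∨
      ((G.deleteEdges {s(v, w)}).Reachable x w ∧ (G.deleteEdges {s(v, w)}).Reachable v y) := by
  obtain ⟨p⟩ := h
  induction p with
  | nil => exact .inl .rfl
  | @cons a b c hab p ih =>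
    by_cases he : s(a, b) = s(v, w)
    · rcases Sym2.eq_iff.1 he with ⟨rfl, rfl⟩ | ⟨rfl, rfl⟩
      · rcases ih with h | ⟨-, h⟩ | ⟨-, h⟩
        · exact .inr (.inl ⟨.rfl, h⟩)
        · exact .inr (.inl ⟨.rfl, h⟩)
        · exact .inl h
      · rcases ih with h | ⟨-, h⟩ | ⟨-, h⟩
        · exact .inr (.inr ⟨.rfl, h⟩)
        · exact .inl h
        · exact .inr (.inr ⟨.rfl, h⟩)
    · have hR : (G.deleteEdges {s(v, w)}).Reachable a b :=
        Adj.reachable (by rw [deleteEdges_adj]; exact ⟨hab, he⟩)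
      rcases ih with h | ⟨h1, h2⟩ | ⟨h1, h2⟩
      · exact .inl (hR.trans h)
      · exact .inr (.inl ⟨hR.trans h1, h2⟩)
      · exact .inr (.inr ⟨hR.trans h1, h2⟩)

lemma map_ofLE_surjective (h : G ≤ H) :
    Function.Surjective (ConnectedComponent.map (Hom.ofLE h)) := by
  intro c
  induction c using ConnectedComponent.ind with
  | h u => exact ⟨G.connectedComponentMk u, rfl⟩

lemma exists_adj_not_adj_of_lt (h : G < H) : ∃ v w, H.Adj v w ∧ ¬ G.Adj v w := by
  by_contra! hc
  exact h.not_ge fun v w hvw ↦ hc v w hvw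

lemma le_deleteEdges_singleton (h : G ≤ H) (hvw : ¬ G.Adj v w) : G ≤ H.deleteEdges {s(v, w)} := by
  intro a b hab
  rw [deleteEdges_adj]
  refine ⟨h hab, fun he ↦ hvw ?_⟩
  rwa [← mem_edgeSet, ← Set.mem_singleton_iff.1 he]

lemma cycleSpaceDim_bot : (⊥ : SimpleGraph V).cycleSpaceDim = 0 := by
  have hc : Nat.card (⊥ : SimpleGraph V).ConnectedComponent = Nat.card V := by
    refine (Nat.card_eq_of_bijective (⊥ : SimpleGraph V).connectedComponentMk ⟨?_, ?_⟩).symm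
    · intro a b hab
      simpa using ConnectedComponent.exact hab
    · exact Quot.mk_surjective
  simp [cycleSpaceDim, hc]

/-- The edge sets of the cycles of `G`. -/
def cycleEdgeSets (G : SimpleGraph V) : Set (Set (Sym2 V)) :=
  {E | ∃ (u : V) (p : G.Walk u u), p.IsCycle ∧ E = p.edgeSet}

lemma cycleEdgeSets_deleteEdges_subset (e : Sym2 V) :
    (G.deleteEdges {e}).cycleEdgeSets ⊆ {E ∈ G.cycleEdgeSets | e ∉ E} := by
  rintro E ⟨u, p, hp, rfl⟩
  refine ⟨⟨u, p.mapLe (deleteEdges_le {e}), hp.mapLe _, ?_⟩, ?_⟩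
  · ext; simp [Walk.mapLe]
  · intro he
    have := p.edges_subset_edgeSet (Walk.mem_edgeSet.1 he)
    simp at this

section Finite

variable [Finite V]

lemma card_edgeSet_deleteEdges_singleton (h : G.Adj v w) :
    Nat.card G.edgeSet = Nat.card (G.deleteEdges {s(v, w)}).edgeSet + 1 := by
  rw [edgeSet_deleteEdges, Nat.card_coe_set_eq, Nat.card_coe_set_eq,
    Set.ncard_sdiff_singleton_add_one (G.mem_edgeSet.2 h) (Set.toFinite _)]

lemma cycleSpaceDim_deleteEdges_of_reachable (h : G.Adj v w)
    (hr : (G.deleteEdges {s(v, w)}).Reachable v w) :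
    (G.deleteEdges {s(v, w)}).cycleSpaceDim = G.cycleSpaceDim - 1 := by
  have hc : Nat.card (G.deleteEdges {s(v, w)}).ConnectedComponent =
      Nat.card G.ConnectedComponent := by
    refine Nat.card_eq_of_bijective _ ⟨?_, map_ofLE_surjective (deleteEdges_le {s(v, w)})⟩
    intro a b hab
    induction a using ConnectedComponent.ind with | h a =>
    induction b using ConnectedComponent.ind with | h b =>
    have hab : G.Reachable a b := ConnectedComponent.exact hab
    refine ConnectedComponent.sound ?_
    rcases hab.deleteEdges_singleton_or v w with h | ⟨h1, h2⟩ | ⟨h1, h2⟩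
    · exact h
    · exact h1.trans (hr.trans h2)
    · exact h1.trans (hr.symm.trans h2)
  have := card_edgeSet_deleteEdges_singleton h
  simp only [cycleSpaceDim, hc, this]
  push_cast
  ring

/-- One edge is lost, and at most one component is gained. -/
lemma cycleSpaceDim_deleteEdges_le (h : G.Adj v w) :
    (G.deleteEdges {s(v, w)}).cycleSpaceDim ≤ G.cycleSpaceDim := by
  classical
  have hc : Nat.card (G.deleteEdges {s(v, w)}).ConnectedComponent ≤
      Nat.card G.ConnectedComponent + 1 := by
    rw [← Finite.card_option]
    -- Only the components of `v` and `w` can merge when the edge is restored, so setting that of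
    -- `w` aside makes the map injective.
    let f : (G.deleteEdges {s(v, w)}).ConnectedComponent → Option G.ConnectedComponent := fun c ↦
      if c = (G.deleteEdges {s(v, w)}).connectedComponentMk w then none
      else some (c.map (Hom.ofLE (deleteEdges_le {s(v, w)})))
    refine Nat.card_le_card_of_injective f ?_
    intro a b hab
    induction a using ConnectedComponent.ind with | h a =>
    induction b using ConnectedComponent.ind with | h b =>
    simp only [f] at hab
    split_ifs at hab with ha hb hb
    · rw [ha, hb]
    · have hab : G.Reachable a b := ConnectedComponent.exact (Option.some.inj hab)
      rcases hab.deleteEdges_singleton_or v w with h | ⟨h1, h2⟩ | ⟨h1, h2⟩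
      · exact ConnectedComponent.sound h
      · exact absurd (ConnectedComponent.sound h2.symm) hb
      · exact absurd (ConnectedComponent.sound h1) ha
  have := card_edgeSet_deleteEdges_singleton h
  simp only [cycleSpaceDim, this]
  push_cast
  linarith [(Nat.cast_le (α := ℤ)).2 hc, Nat.cast_succ (R := ℤ) (Nat.card G.ConnectedComponent)]

/-- Restoring a bridge merges the components of its ends, so the surjection on components is not
injective and deletion gains at least one. -/
lemma cycleSpaceDim_le_deleteEdges_of_not_reachable (h : G.Adj v w)
    (hr : ¬ (G.deleteEdges {s(v, w)}).Reachable v w) :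
    G.cycleSpaceDim ≤ (G.deleteEdges {s(v, w)}).cycleSpaceDim := by
  have hc : Nat.card G.ConnectedComponent <
      Nat.card (G.deleteEdges {s(v, w)}).ConnectedComponent := by
    have hs := map_ofLE_surjective (deleteEdges_le (G := G) {s(v, w)})
    refine lt_of_le_of_ne (Nat.card_le_card_of_surjective _ hs) fun heq ↦ hr ?_
    have hb := hs.bijective_of_nat_card_le heq.symm.le
    exact ConnectedComponent.exact (hb.1 (ConnectedComponent.sound h.reachable :
      G.connectedComponentMk v = G.connectedComponentMk w))
  have := card_edgeSet_deleteEdges_singleton h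
  simp only [cycleSpaceDim, this]
  push_cast
  linarith [(Nat.cast_le (α := ℤ)).2 hc, Nat.cast_succ (R := ℤ) (Nat.card G.ConnectedComponent)]

lemma cycleSpaceDim_mono (h : G ≤ H) : G.cycleSpaceDim ≤ H.cycleSpaceDim := by
  induction hn : Nat.card H.edgeSet generalizing H with
  | zero =>
    rcases h.eq_or_lt with rfl | hlt
    · rfl
    · obtain ⟨v, w, hvw, -⟩ := exists_adj_not_adj_of_lt hlt
      have := card_edgeSet_deleteEdges_singleton hvw
      omega
  | succ n ih =>
    rcases h.eq_or_lt with rfl | hlt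
    · rfl
    · obtain ⟨v, w, hvw, hvw'⟩ := exists_adj_not_adj_of_lt hlt
      have := card_edgeSet_deleteEdges_singleton hvw
      exact (ih (le_deleteEdges_singleton h hvw') (by omega)).trans
        (cycleSpaceDim_deleteEdges_le hvw)

lemma cycleSpaceDim_nonneg : 0 ≤ G.cycleSpaceDim :=
  cycleSpaceDim_bot.symm.le.trans (cycleSpaceDim_mono bot_le)

/-- Delete edges one by one: a bridge does not lower `ω`, while any other edge lowers it by one and
destroys at least one cycle. -/
lemma cycleSpaceDim_le_ncard_cycleEdgeSets : G.cycleSpaceDim ≤ G.cycleEdgeSets.ncard := by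
  induction hn : Nat.card G.edgeSet generalizing G with
  | zero =>
    have : G = ⊥ := by
      by_contra hne
      obtain ⟨v, w, hvw, -⟩ := exists_adj_not_adj_of_lt (bot_lt_iff_ne_bot.2 hne)
      have := card_edgeSet_deleteEdges_singleton hvw
      omega
    subst this
    simp [cycleSpaceDim_bot]
  | succ n ih =>
    have hne : G ≠ ⊥ := by rintro rfl; simp at hn
    obtain ⟨v, w, hvw, -⟩ := exists_adj_not_adj_of_lt (bot_lt_iff_ne_bot.2 hne)
    have hcard := card_edgeSet_deleteEdges_singleton hvw
    have ih := ih (G := G.deleteEdges {s(v, w)}) (by omega)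
    have hsub := cycleEdgeSets_deleteEdges_subset (G := G) s(v, w)
    by_cases hr : (G.deleteEdges {s(v, w)}).Reachable v w
    · rw [cycleSpaceDim_deleteEdges_of_reachable hvw hr] at ih
      obtain ⟨u, p, hp, he⟩ := adj_and_reachable_delete_edges_iff_exists_cycle.1 ⟨hvw, hr⟩
      have hlt : (G.deleteEdges {s(v, w)}).cycleEdgeSets.ncard < G.cycleEdgeSets.ncard := by
        refine Set.ncard_lt_ncard ⟨fun E hE ↦ (hsub hE).1, fun hs ↦ ?_⟩ (Set.toFinite _)
        exact (hsub (hs ⟨u, p, hp, rfl⟩)).2 (Walk.mem_edgeSet.2 he)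
      omega
    · have hle : (G.deleteEdges {s(v, w)}).cycleEdgeSets.ncard ≤ G.cycleEdgeSets.ncard :=
        Set.ncard_le_ncard (fun E hE ↦ (hsub hE).1) (Set.toFinite _)
      have := cycleSpaceDim_le_deleteEdges_of_not_reachable hvw hr
      omega

lemma IsAcyclic.cycleSpaceDim_eq_zero (h : G.IsAcyclic) : G.cycleSpaceDim = 0 := by
  refine le_antisymm (cycleSpaceDim_le_ncard_cycleEdgeSets.trans ?_) cycleSpaceDim_nonneg
  have : G.cycleEdgeSets = ∅ := by
    ext E
    simp only [cycleEdgeSets, Set.mem_ofPred_eq, Set.mem_empty_iff_false, iff_false]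
    rintro ⟨u, p, hp, -⟩
    exact h p hp
  simp [this]

/-- As `v` is isolated in `G`, the smaller graph avoids a non-bridge of `H` at `v`; monotonicity
does the rest. -/
lemma OnCycle.cycleSpaceDim_lt (h : H.OnCycle v) (hGH : G ≤ H) (hv : ∀ w, ¬ G.Adj v w) :
    G.cycleSpaceDim + 1 ≤ H.cycleSpaceDim := by
  obtain ⟨w, hvw, hr⟩ := h
  have := cycleSpaceDim_mono (le_deleteEdges_singleton hGH (hv w))
  rw [cycleSpaceDim_deleteEdges_of_reachable hvw hr] at this
  omega

end Finite

end CycleSpace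

/-! ### Connected vertex sets, and sets without connected four-sets -/

section ConnectedSets

variable {V : Type*} {G H : SimpleGraph V} {A B K S Z : Finset V} {v w x y : V}

lemma Reachable.of_invariant {P : V → Prop} (h : G.Reachable x y) (hx : P x)
    (hP : ∀ a b, G.Adj a b → P a → P b) : P y := by
  obtain ⟨p⟩ := h
  induction p with
  | nil => exact hx
  | cons hab p ih => exact ih (hP _ _ hab hx)

/-- The spanning subgraph of `G` formed by the edges with both ends in `A`. -/
def within (G : SimpleGraph V) (A : Finset V) : SimpleGraph V where
  Adj v w := G.Adj v w ∧ v ∈ A ∧ w ∈ A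
  symm := ⟨fun _ _ h ↦ ⟨h.1.symm, h.2.2, h.2.1⟩⟩
  loopless := ⟨fun _ h ↦ h.1.ne rfl⟩

lemma within_adj : (G.within A).Adj v w ↔ G.Adj v w ∧ v ∈ A ∧ w ∈ A := Iff.rfl

lemma within_mono (h : A ⊆ B) : G.within A ≤ G.within B := fun _ _ hab ↦
  ⟨hab.1, h hab.2.1, h hab.2.2⟩

@[simp] lemma within_univ [Fintype V] : G.within Finset.univ = G := by
  ext; simp [within_adj]

lemma Reachable.mem_of_within (h : (G.within A).Reachable x y) (hx : x ∈ A) : y ∈ A :=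
  h.of_invariant (P := (· ∈ A)) hx fun _ _ hab _ ↦ hab.2.2

/-- A nonempty set of vertices that induces a connected subgraph. -/
def IsConnectedSet (G : SimpleGraph V) (A : Finset V) : Prop :=
  A.Nonempty ∧ ∀ x ∈ A, ∀ y ∈ A, (G.within A).Reachable x y

lemma reachable_induce_iff {x y : (A : Set V)} :
    (G.induce (A : Set V)).Reachable x y ↔ (G.within A).Reachable x y := by
  constructor
  · intro h
    let f : G.induce (A : Set V) →g G.within A :=
      ⟨Subtype.val, fun {a b} hab ↦ ⟨hab, a.2, b.2⟩⟩
    exact h.map f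
  · intro h
    obtain ⟨_, h⟩ := h.of_invariant
      (P := fun y ↦ ∃ hy, (G.induce (A : Set V)).Reachable x ⟨y, hy⟩) ⟨x.2, .rfl⟩
      fun a b hab ⟨ha, hr⟩ ↦ ⟨hab.2.2, hr.trans (Adj.reachable (by simpa using hab.1))⟩
    exact h

lemma isConnectedSet_iff_induce : G.IsConnectedSet A ↔ (G.induce (A : Set V)).Connected := by
  constructor
  · rintro ⟨⟨z, hz⟩, h⟩
    rw [connected_iff]
    exact ⟨fun x y ↦ reachable_induce_iff.2 (h x x.2 y y.2), ⟨z, hz⟩⟩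
  · intro h
    obtain ⟨z, hz⟩ := h.nonempty
    exact ⟨⟨z, hz⟩, fun x hx y hy ↦
      reachable_induce_iff.1 (h.preconnected ⟨x, hx⟩ ⟨y, hy⟩)⟩

lemma IsConnectedSet.subset_of_closed (hB : G.IsConnectedSet B) (hx : x ∈ B) (hxK : x ∈ K)
    (hK : ∀ a ∈ K, ∀ b ∈ B, G.Adj a b → b ∈ K) : B ⊆ K := fun y hy ↦
  (hB.2 x hx y hy).of_invariant (P := (· ∈ K)) hxK fun a b hab ha ↦ hK a ha b hab.2.2 hab.1

lemma isConnectedSet_singleton (v : V) : G.IsConnectedSet {v} := by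
  refine ⟨⟨v, by simp⟩, fun x hx y hy ↦ ?_⟩
  rw [Finset.mem_singleton.1 hx, Finset.mem_singleton.1 hy]

lemma isConnectedSet_of_forall_reachable (hv : v ∈ A)
    (h : ∀ x ∈ A, (G.within A).Reachable x v) : G.IsConnectedSet A :=
  ⟨⟨v, hv⟩, fun x hx y hy ↦ (h x hx).trans (h y hy).symm⟩

open scoped Classical in
/-- The vertex set of the component of `x` in the subgraph induced by `Z`. -/
noncomputable def componentIn (G : SimpleGraph V) (Z : Finset V) (x : V) : Finset V :=
  Z.filter ((G.within Z).Reachable x)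

lemma mem_componentIn : y ∈ G.componentIn Z x ↔ y ∈ Z ∧ (G.within Z).Reachable x y := by
  simp [componentIn]

lemma componentIn_subset : G.componentIn Z x ⊆ Z := fun _ h ↦ (mem_componentIn.1 h).1

lemma self_mem_componentIn (hx : x ∈ Z) : x ∈ G.componentIn Z x := mem_componentIn.2 ⟨hx, .rfl⟩

lemma mem_componentIn_of_adj (hv : v ∈ G.componentIn Z x) (hw : w ∈ Z) (h : G.Adj v w) :
    w ∈ G.componentIn Z x := by
  rw [mem_componentIn] at hv ⊢
  exact ⟨hw, hv.2.trans (Adj.reachable ⟨h, hv.1, hw⟩)⟩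

lemma isConnectedSet_componentIn (hx : x ∈ Z) : G.IsConnectedSet (G.componentIn Z x) := by
  refine isConnectedSet_of_forall_reachable (self_mem_componentIn hx) fun y hy ↦ .symm ?_
  refine ((mem_componentIn.1 hy).2.of_invariant (P := fun y ↦ y ∈ G.componentIn Z x ∧
    (G.within (G.componentIn Z x)).Reachable x y) ⟨self_mem_componentIn hx, .rfl⟩ ?_).2
  intro a b hab ⟨ha, hr⟩
  have hb := mem_componentIn_of_adj ha hab.2.2 hab.1
  exact ⟨hb, hr.trans (Adj.reachable ⟨hab.1, ha, hb⟩)⟩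

lemma IsConnectedSet.subset_componentIn (hB : G.IsConnectedSet B) (hBZ : B ⊆ Z) (hx : x ∈ B) :
    B ⊆ G.componentIn Z x := fun y hy ↦
  mem_componentIn.2 ⟨hBZ hy, (hB.2 x hx y hy).mono (within_mono hBZ)⟩

lemma componentIn_eq_of_mem (hy : y ∈ G.componentIn Z x) :
    G.componentIn Z y = G.componentIn Z x := by
  ext z
  have hr := (mem_componentIn.1 hy).2
  simp only [mem_componentIn]
  exact and_congr_right fun _ ↦ ⟨fun h ↦ hr.trans h, fun h ↦ hr.symm.trans h⟩

lemma dvd_card_of_dvd_card_componentIn {n : ℕ} (h : ∀ x ∈ Z, n ∣ (G.componentIn Z x).card) :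
    n ∣ Z.card := by
  classical
  rw [Finset.card_eq_sum_card_image (G.componentIn Z) Z]
  refine Finset.dvd_sum fun B hB ↦ ?_
  obtain ⟨x, hx, rfl⟩ := Finset.mem_image.1 hB
  have hfib : Z.filter (fun y ↦ G.componentIn Z y = G.componentIn Z x) = G.componentIn Z x := by
    ext y
    simp only [Finset.mem_filter]
    constructor
    · rintro ⟨hy, he⟩
      exact he ▸ self_mem_componentIn hy
    · exact fun hy ↦ ⟨componentIn_subset hy, componentIn_eq_of_mem hy⟩
  rw [hfib]
  exact h x hx

lemma within_le_deleteEdges (hBA : B ⊆ A) (hw : w ∉ B) :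
    G.within B ≤ (G.within A).deleteEdges {s(v, w)} := by
  intro a b hab
  rw [deleteEdges_adj]
  refine ⟨within_mono hBA hab, fun he ↦ ?_⟩
  rcases Sym2.eq_iff.1 (Set.mem_singleton_iff.1 he) with ⟨-, rfl⟩ | ⟨rfl, -⟩
  · exact hw hab.2.2
  · exact hw hab.2.1

variable [DecidableEq V]

/-- Two different edges that leave a connected set `K` and whose outer ends are joined outside `K`
lie on a cycle. -/
lemma IsConnectedSet.onCycle_of_two_edges (hK : G.IsConnectedSet K) (hKA : K ⊆ A) {u u' k k' : V}
    (hu : u ∈ A) (huK : u ∉ K) (hu' : u' ∈ A) (hk : k ∈ K) (hk' : k' ∈ K)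
    (h : G.Adj k u) (h' : G.Adj k' u') (hne : u ≠ u' ∨ k ≠ k')
    (hr : (G.within (A \ K)).Reachable u u') : (G.within A).OnCycle k := by
  have hu'K : u' ∉ K :=
    (Finset.mem_sdiff.1 (hr.mem_of_within (Finset.mem_sdiff.2 ⟨hu, huK⟩))).2
  refine ⟨u, ⟨h, hKA hk, hu⟩, ?_⟩
  have h1 : ((G.within A).deleteEdges {s(k, u)}).Reachable k k' :=
    (hK.2 k hk k' hk').mono (within_le_deleteEdges hKA huK)
  have h2 : ((G.within A).deleteEdges {s(k, u)}).Adj k' u' := by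
    rw [deleteEdges_adj]
    refine ⟨⟨h', hKA hk', hu'⟩, fun he ↦ ?_⟩
    rcases Sym2.eq_iff.1 (Set.mem_singleton_iff.1 he) with ⟨rfl, rfl⟩ | ⟨rfl, -⟩
    · simp at hne
    · exact huK hk'
  have h3 : ((G.within A).deleteEdges {s(k, u)}).Reachable u' u := by
    rw [Sym2.eq_swap]
    exact hr.symm.mono (within_le_deleteEdges Finset.sdiff_subset (by simp [hk]))
  exact h1.trans (h2.reachable.trans h3)

lemma IsAcyclic.eq_of_adj_of_isConnectedSet (hA : (G.within A).IsAcyclic)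
    (hK : G.IsConnectedSet K) (hKA : K ⊆ A) (hv : v ∈ A) (hvK : v ∉ K) (hx : x ∈ K) (hy : y ∈ K)
    (hvx : G.Adj v x) (hvy : G.Adj v y) : x = y := by
  by_contra hne
  exact isAcyclic_iff_forall_not_onCycle.1 hA x
    (hK.onCycle_of_two_edges hKA hv hvK hv hx hy hvx.symm hvy.symm (.inr hne) .rfl)

lemma IsConnectedSet.union_of_adj (hA : G.IsConnectedSet A) (hB : G.IsConnectedSet B)
    (hx : x ∈ A) (hy : y ∈ B) (h : G.Adj x y) : G.IsConnectedSet (A ∪ B) := by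
  have hxy : (G.within (A ∪ B)).Adj x y := ⟨h, by simp [hx], by simp [hy]⟩
  refine isConnectedSet_of_forall_reachable (v := x) (by simp [hx]) fun z hz ↦ ?_
  rcases Finset.mem_union.1 hz with hz | hz
  · exact (hA.2 z hz x hx).mono (within_mono Finset.subset_union_left)
  · exact ((hB.2 z hz y hy).mono (within_mono Finset.subset_union_right)).trans
      hxy.symm.reachable

lemma IsConnectedSet.exists_adj_sdiff (hA : G.IsConnectedSet A) (hBA : B ⊆ A) (hB : B.Nonempty)
    (hne : B ≠ A) : ∃ x ∈ B, ∃ y ∈ A, y ∉ B ∧ G.Adj x y := by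
  by_contra! hc
  obtain ⟨x, hx⟩ := hB
  exact hne (hBA.antisymm (hA.subset_of_closed (hBA hx) hx fun a ha b hb hab ↦ by
    by_contra hbB
    exact hc a ha b hb hbB hab))

/-- Removing from a connected set a part attached by edges at a single outer vertex keeps it
connected. -/
lemma IsConnectedSet.sdiff (hA : G.IsConnectedSet A) (hv : v ∈ A) (hvB : v ∉ B)
    (h : ∀ x ∈ A, x ∉ B → ∀ y ∈ B, G.Adj x y → x = v) : G.IsConnectedSet (A \ B) := by
  refine isConnectedSet_of_forall_reachable (v := v) (by simp [hv, hvB]) fun x hx ↦ ?_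
  rw [Finset.mem_sdiff] at hx
  obtain ⟨p⟩ := hA.2 x hx.1 v hv
  induction p with
  | nil => rfl
  | @cons a b c hab p ih =>
    by_cases hb : b ∈ B
    · rw [h a hx.1 hx.2 b hb hab.1]
    · exact (Adj.reachable (G := G.within (A \ B))
        ⟨hab.1, by simp [hx], by simp [hb, hab.2.2]⟩).trans (ih hv hvB h ⟨hab.2.2, hb⟩)

/-- No four vertices of `S` induce a connected subgraph. -/
def HasNoConnectedFour (G : SimpleGraph V) (S : Finset V) : Prop :=
  ∀ B ⊆ S, G.IsConnectedSet B → B.card ≠ 4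

omit [DecidableEq V] in
lemma hasNoConnectedFour_of_card_lt (h : S.card < 4) : G.HasNoConnectedFour S := fun _ hB _ ↦
  ((Finset.card_le_card hB).trans_lt h).ne

lemma HasNoConnectedFour.union {S' : Finset V} (h : G.HasNoConnectedFour S)
    (h' : G.HasNoConnectedFour S') (hSS : ∀ x ∈ S, ∀ y ∈ S', ¬ G.Adj x y) :
    G.HasNoConnectedFour (S ∪ S') := by
  intro B hB hBc
  obtain ⟨z, hz⟩ := hBc.1
  rcases Finset.mem_union.1 (hB hz) with hzS | hzS
  · refine h B (hBc.subset_of_closed hz hzS fun a ha b hb hab ↦ ?_) hBc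
    rcases Finset.mem_union.1 (hB hb) with hbS | hbS
    · exact hbS
    · exact (hSS a ha b hbS hab).elim
  · refine h' B (hBc.subset_of_closed hz hzS fun a ha b hb hab ↦ ?_) hBc
    rcases Finset.mem_union.1 (hB hb) with hbS | hbS
    · exact (hSS b hbS a ha hab.symm).elim
    · exact hbS

-- A connected four-set has a spanning tree; conversely, the image of a tree on four vertices is a
-- connected four-set.
omit [DecidableEq V] in
lemma isGenIndepSet_four_iff : G.IsGenIndepSet 4 S ↔ G.HasNoConnectedFour S := by
  constructor
  · intro h B hBS hB hcard
    obtain ⟨T, hT, htree⟩ := (isConnectedSet_iff_induce.1 hB).exists_isTree_le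
    let e : Fin 4 ≃ (B : Set V) := (finCongr hcard.symm).trans B.equivFin.symm
    have htree' : (T.comap e).IsTree := (Iso.isTree_iff (Iso.comap e T)).2 htree
    refine h _ htree' ⟨⟨⟨fun i ↦ ⟨e i, hBS (e i).2⟩, fun {a b} hab ↦ ?_⟩, fun a b hab ↦ ?_⟩⟩
    · exact hT hab
    · exact e.injective (Subtype.ext (congrArg (fun z : (S : Set V) ↦ (z : V)) hab))
  · rintro h T hT ⟨f⟩
    let g : Fin 4 ↪ V := f.toEmbedding.trans (Function.Embedding.subtype _)
    refine h (Finset.univ.map g) ?_ ⟨⟨g 0, by simp⟩, ?_⟩ (by simp)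
    · intro x hx
      obtain ⟨i, -, rfl⟩ := Finset.mem_map.1 hx
      exact (f i).2
    · intro x hx y hy
      obtain ⟨i, -, rfl⟩ := Finset.mem_map.1 hx
      obtain ⟨j, -, rfl⟩ := Finset.mem_map.1 hy
      let φ : T →g G.within (Finset.univ.map g) :=
        ⟨g, fun {a b} hab ↦ ⟨f.toHom.map_adj hab, by simp, by simp⟩⟩
      exact (hT.connected.preconnected i j).map φ

end ConnectedSets

/-! ### Forests: the lower bound and its extremal trees -/

section Forests

variable {V : Type u} {G : SimpleGraph V} {A B : Finset V}

lemma injective_vecFour {a b c d : V} (hab : a ≠ b) (hac : a ≠ c) (had : a ≠ d) (hbc : b ≠ c)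
    (hbd : b ≠ d) (hcd : c ≠ d) : Function.Injective ![a, b, c, d] := by
  intro i j hij
  fin_cases i <;> fin_cases j <;> simp_all [eq_comm]

lemma nonempty_induce_iso_of_injective {P : SimpleGraph (Fin 4)} {g : Fin 4 → V}
    (hg : Function.Injective g) (hgB : ∀ i, g i ∈ B) (hB : B.card = 4)
    (h : ∀ i j, G.Adj (g i) (g j) ↔ P.Adj i j) : Nonempty (G.induce (B : Set V) ≃g P) := by
  let f : Fin 4 → (B : Set V) := fun i ↦ ⟨g i, hgB i⟩
  have hf : f.Bijective := by
    rw [Fintype.bijective_iff_injective_and_card]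
    refine ⟨fun i j hij ↦ hg (congrArg (fun z : (B : Set V) ↦ (z : V)) hij), ?_⟩
    simp [hB]
  exact ⟨Iso.symm ⟨Equiv.ofBijective f hf, fun {i j} ↦ h i j⟩⟩

variable [DecidableEq V]

/-- A tree on four vertices is a path or a star. -/
lemma IsConnectedSet.nonempty_iso_path_or_star (hB : G.IsConnectedSet B)
    (hac : (G.within B).IsAcyclic) (hcard : B.card = 4) :
    Nonempty (G.induce (B : Set V) ≃g pathGraph 4) ∨
      Nonempty (G.induce (B : Set V) ≃g starGraph (0 : Fin 4)) := by
  have hex : ∃ a ∈ B, ∃ b ∈ B, ∃ c ∈ B, b ≠ c ∧ G.Adj a b ∧ G.Adj a c := by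
    obtain ⟨a, ha⟩ := hB.1
    obtain ⟨x, hx, b, hb, -, hab⟩ := hB.exists_adj_sdiff (B := {a}) (by simpa using ha)
      (by simp) (by rintro rfl; simp at hcard)
    rw [Finset.mem_singleton.1 hx] at hab
    obtain ⟨x, hx, c, hc, hcab, hxc⟩ := hB.exists_adj_sdiff (B := {a, b})
      (by simp [Finset.insert_subset_iff, ha, hb]) (by simp)
      (by rintro rfl; have := Finset.card_le_two (a := a) (b := b); omega)
    simp only [Finset.mem_insert, Finset.mem_singleton, not_or] at hx hcab
    rcases hx with rfl | rfl
    · exact ⟨x, ha, b, hb, c, hc, Ne.symm hcab.2, hab, hxc⟩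
    · exact ⟨x, hb, a, ha, c, hc, Ne.symm hcab.1, hab.symm, hxc⟩
  obtain ⟨a, ha, b, hb, c, hc, hbc, hab, hac'⟩ := hex
  have hcab : G.IsConnectedSet {a, b, c} := by
    have h1 := (isConnectedSet_singleton (G := G) a).union_of_adj (isConnectedSet_singleton b)
      (Finset.mem_singleton_self a) (Finset.mem_singleton_self b) hab
    have h2 := h1.union_of_adj (isConnectedSet_singleton c) (x := a) (by simp)
      (Finset.mem_singleton_self c) hac'
    convert h2 using 1
    ext; simp
  have hsub : ({a, b, c} : Finset V) ⊆ B := by simp [Finset.insert_subset_iff, ha, hb, hc]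
  obtain ⟨x, hx, d, hd, hdn, hxd⟩ := hB.exists_adj_sdiff hsub (by simp)
    (by intro he; have := Finset.card_le_three (a := a) (b := b) (c := c); rw [he] at this; omega)
  -- A second neighbour of `d` in the connected set `{a, b, c}` would close a cycle.
  have huniq : ∀ y ∈ ({a, b, c} : Finset V), G.Adj d y → y = x := fun y hy hdy ↦
    hac.eq_of_adj_of_isConnectedSet hcab hsub hd hdn hy hx hdy hxd.symm
  have hbc' : ¬ G.Adj b c := by
    intro hadj
    have h1 : G.IsConnectedSet {a, c} :=
      (isConnectedSet_singleton (G := G) a).union_of_adj (isConnectedSet_singleton c)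
        (Finset.mem_singleton_self a) (Finset.mem_singleton_self c) hac'
    exact hac'.ne (hac.eq_of_adj_of_isConnectedSet h1
      (by simp [Finset.insert_subset_iff, ha, hc]) hb (by simp [hab.ne', hbc]) (by simp)
      (by simp) hab.symm hadj)
  have hpath : ∀ p ∈ B, ∀ q ∈ B, ∀ r ∈ B, ∀ s ∈ B, G.Adj p q → G.Adj q r → G.Adj r s →
      ¬ G.Adj p r → ¬ G.Adj p s → ¬ G.Adj q s → p ≠ r → p ≠ s → q ≠ s →
      Nonempty (G.induce (B : Set V) ≃g pathGraph 4) := by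
    intro p hp q hq r hr s hs h1 h2 h3 h4 h5 h6 h7 h8 h9
    have h4' : ¬ G.Adj r p := fun h ↦ h4 h.symm
    have h5' : ¬ G.Adj s p := fun h ↦ h5 h.symm
    have h6' : ¬ G.Adj s q := fun h ↦ h6 h.symm
    refine nonempty_induce_iso_of_injective (g := ![p, q, r, s]) ?_ ?_ hcard ?_
    · exact injective_vecFour h1.ne h7 h8 h2.ne h9 h3.ne
    · intro i
      fin_cases i <;> simp [hp, hq, hr, hs]
    · intro i j
      fin_cases i <;> fin_cases j <;>
        simp [pathGraph_adj, h1, h1.symm, h2, h2.symm, h3, h3.symm, h4, h4', h5, h5', h6, h6']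
  simp only [Finset.mem_insert, Finset.mem_singleton, not_or, forall_eq_or_imp, forall_eq]
    at hx hdn huniq
  obtain ⟨hda, hdb, hdc⟩ := hdn
  obtain ⟨ua, ub, uc⟩ := huniq
  -- Attaching `d` to the centre `a` gives a star, attaching it to `b` or `c` gives a path.
  rcases hx with rfl | rfl | rfl
  · right
    have hb' : ¬ G.Adj d b := fun h ↦ hab.ne' (ub h)
    have hc' : ¬ G.Adj d c := fun h ↦ hac'.ne' (uc h)
    have hb'' : ¬ G.Adj b d := fun h ↦ hb' h.symm
    have hc'' : ¬ G.Adj c d := fun h ↦ hc' h.symm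
    have hcb' : ¬ G.Adj c b := fun h ↦ hbc' h.symm
    refine nonempty_induce_iso_of_injective (g := ![x, b, c, d]) ?_ ?_ hcard ?_
    · exact injective_vecFour hab.ne hac'.ne hxd.ne hbc (Ne.symm hdb) (Ne.symm hdc)
    · intro i
      fin_cases i <;> simp [ha, hb, hc, hd]
    · intro i j
      fin_cases i <;> fin_cases j <;>
        simp [starGraph_adj, hab, hab.symm, hac', hac'.symm, hxd, hxd.symm, hb', hc', hb'', hc'',
          hbc', hcb']
  · left
    exact hpath d hd x hb a ha c hc hxd.symm hab.symm hac' (fun h ↦ hab.ne (ua h))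
      (fun h ↦ hbc.symm (uc h)) hbc' hda hdc hbc
  · left
    exact hpath d hd x hc a ha b hb hxd.symm hac'.symm hab (fun h ↦ hac'.ne (ua h))
      (fun h ↦ hbc (ub h)) (fun h ↦ hbc' h.symm) hda hdb hbc.symm

/-- A tree with at least four vertices can be split at a vertex `v` into a part `B` all of whose
branches at `v` have at most three vertices and a remaining tree joined to `v` by one edge. -/
lemma IsConnectedSet.exists_split (hA : G.IsConnectedSet A) (hac : (G.within A).IsAcyclic)
    (hcard : 4 ≤ A.card) : ∃ B ⊆ A, ∃ v ∈ B, G.IsConnectedSet B ∧ 4 ≤ B.card ∧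
      G.HasNoConnectedFour (B.erase v) ∧ (B = A ∨ ∃ p ∈ A, p ∉ B ∧ G.Adj v p ∧
        ∀ x ∈ B, ∀ y ∈ A, y ∉ B → G.Adj x y → x = v ∧ y = p) := by
  obtain ⟨v, hv⟩ := hA.1
  -- Descend through ever smaller subtrees `B` with root `v`, keeping the invariant that at most one
  -- edge leaves `B` inside `A`, and that it starts at `v`.
  suffices h : ∀ B ⊆ A, ∀ v ∈ B, G.IsConnectedSet B → 4 ≤ B.card →
      (B = A ∨ ∃ p ∈ A, p ∉ B ∧ G.Adj v p ∧
        ∀ x ∈ B, ∀ y ∈ A, y ∉ B → G.Adj x y → x = v ∧ y = p) →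
      ∃ B ⊆ A, ∃ v ∈ B, G.IsConnectedSet B ∧ 4 ≤ B.card ∧
      G.HasNoConnectedFour (B.erase v) ∧ (B = A ∨ ∃ p ∈ A, p ∉ B ∧ G.Adj v p ∧
        ∀ x ∈ B, ∀ y ∈ A, y ∉ B → G.Adj x y → x = v ∧ y = p) from
    h A subset_rfl v hv hA hcard (.inl rfl)
  intro B
  induction B using Finset.strongInduction with
  | H B ih =>
    intro hBA v hv hB hB4 hout
    by_cases hS : G.HasNoConnectedFour (B.erase v)
    · exact ⟨B, hBA, v, hv, hB, hB4, hS, hout⟩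
    simp only [HasNoConnectedFour, not_forall, not_not] at hS
    obtain ⟨X, hXB, hX, hX4⟩ := hS
    obtain ⟨x, hx⟩ := hX.1
    have hC := isConnectedSet_componentIn (G := G) (hXB hx)
    have hXC := hX.subset_componentIn hXB hx
    set C := G.componentIn (B.erase v) x with hCdef
    have hCB : C ⊆ B.erase v := componentIn_subset
    have hvC : v ∉ C := fun h ↦ by simpa using hCB h
    have hCB' : C ⊂ B := ⟨hCB.trans (Finset.erase_subset _ _), fun h ↦ hvC (h hv)⟩
    have hclosed : ∀ a ∈ C, ∀ b ∈ B, b ∉ C → G.Adj a b → b = v := by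
      intro a ha b hb hbC hab
      by_contra hbv
      exact hbC (mem_componentIn_of_adj ha (Finset.mem_erase.2 ⟨hbv, hb⟩) hab)
    obtain ⟨w, hw, y, hy, hyC, hwy⟩ := hB.exists_adj_sdiff hCB'.1 hC.1 hCB'.ne
    obtain rfl := hclosed w hw y hy hyC hwy
    -- The branch `C` at the old root has at least four vertices; it becomes the new subtree, rooted
    -- at its vertex `w` adjacent to the old root.
    refine ih C hCB' (hCB'.1.trans hBA) w hw hC (hX4 ▸ Finset.card_le_card hXC)
      (.inr ⟨y, hBA hv, hvC, hwy, fun a ha b hb hbC hab ↦ ?_⟩)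
    by_cases hbB : b ∈ B
    · obtain rfl := hclosed a ha b hbB hbC hab
      exact ⟨hac.eq_of_adj_of_isConnectedSet hC (hCB'.1.trans hBA) hb hbC ha hw hab.symm
        hwy.symm, rfl⟩
    · rcases hout with rfl | ⟨p, -, -, -, hp⟩
      · exact (hbB hb).elim
      · exact (hvC ((hp a (hCB'.1 ha) b hb hbB hab).1 ▸ ha)).elim

lemma nonempty_iso_joinByEdge {P : SimpleGraph (Fin 4)} {v p : V} (hBA : B ⊆ A) (hv : v ∈ B)
    (hp : p ∈ A) (hpB : p ∉ B) (hvp : G.Adj v p)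
    (h : ∀ x ∈ B, ∀ y ∈ A, y ∉ B → G.Adj x y → x = v ∧ y = p)
    (f : G.induce (B : Set V) ≃g P) :
    Nonempty (G.induce (A : Set V) ≃g joinByEdge (G.induce ((A \ B : Finset V) : Set V)) P
      ⟨p, by simp [hp, hpB]⟩ (f ⟨v, hv⟩)) := by
  let g : ((A \ B : Finset V) : Set V) ⊕ Fin 4 → (A : Set V) :=
    Sum.elim (fun x ↦ ⟨x, (Finset.mem_sdiff.1 x.2).1⟩) (fun i ↦ ⟨f.symm i, hBA (f.symm i).2⟩)
  have hg : g.Bijective := by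
    constructor
    · rintro (x | i) (y | j) hxy <;> have hxy := congrArg (fun z : (A : Set V) ↦ (z : V)) hxy <;>
        simp only [g, Sum.elim_inl, Sum.elim_inr] at hxy
      · rw [Subtype.ext hxy]
      · exact ((Finset.mem_sdiff.1 x.2).2 (hxy ▸ (f.symm j).2)).elim
      · exact ((Finset.mem_sdiff.1 y.2).2 (hxy ▸ (f.symm i).2)).elim
      · rw [f.symm.injective (Subtype.ext hxy)]
    · rintro ⟨x, hx⟩
      by_cases hxB : x ∈ B
      · exact ⟨.inr (f ⟨x, hxB⟩), by simp [g]⟩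
      · exact ⟨.inl ⟨x, Finset.mem_sdiff.2 ⟨hx, hxB⟩⟩, rfl⟩
  have hcross : ∀ (x : ((A \ B : Finset V) : Set V)) (i : Fin 4),
      G.Adj x (f.symm i) ↔ (x : V) = p ∧ i = f ⟨v, hv⟩ := by
    intro x i
    constructor
    · intro hadj
      obtain ⟨h1, h2⟩ := h _ (f.symm i).2 x (Finset.mem_sdiff.1 x.2).1 (Finset.mem_sdiff.1 x.2).2
        hadj.symm
      refine ⟨h2, ?_⟩
      have : f.symm i = ⟨v, hv⟩ := Subtype.ext h1
      rw [← this, RelIso.apply_symm_apply]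
    · rintro ⟨h1, rfl⟩
      rw [h1, RelIso.symm_apply_apply]
      exact hvp.symm
  refine ⟨Iso.symm ⟨Equiv.ofBijective g hg, ?_⟩⟩
  rintro (x | i) (y | j)
  · simp [g, joinByEdge, edge_adj]
  · simp only [Equiv.ofBijective_apply, comap_adj, Function.Embedding.subtype_apply, g,
      Sum.elim_inl, Sum.elim_inr, hcross]
    simp [joinByEdge, edge_adj, Subtype.ext_iff]
  · simp only [Equiv.ofBijective_apply, comap_adj, Function.Embedding.subtype_apply, g,
      Sum.elim_inl, Sum.elim_inr, G.adj_comm _ (y : V), hcross]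
    simp [joinByEdge, edge_adj, Subtype.ext_iff, and_comm]
  · have := f.symm.map_adj_iff (v := i) (w := j)
    simp only [comap_adj, Function.Embedding.subtype_apply] at this
    simp [g, joinByEdge, edge_adj, this]

/-- A forest on `A` has a set with at least `3|A|/4` vertices without connected four-sets, and
more than `3|A|/4` if it is a tree outside the Li–Zhou families. -/
lemma IsAcyclic.exists_hasNoConnectedFour (hac : (G.within A).IsAcyclic) :
    ∃ S ⊆ A, G.HasNoConnectedFour S ∧ 3 * A.card ≤ 4 * S.card ∧ (G.IsConnectedSet A →
      3 * A.card < 4 * S.card ∨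
        ∃ i, A.card = 4 * i ∧ LiZhou i (G.induce (A : Set V))) := by
  induction A using Finset.strongInduction with
  | H A ih =>
    have ih' : ∀ B ⊂ A, _ := fun B hB ↦ ih B hB (hac.anti (within_mono hB.1))
    by_cases hA : G.IsConnectedSet A
    · rcases lt_or_ge A.card 4 with hA4 | hA4
      · have := hA.1.card_pos
        exact ⟨A, subset_rfl, hasNoConnectedFour_of_card_lt hA4, by omega,
          fun _ ↦ .inl (by omega)⟩
      obtain ⟨B, hBA, v, hv, hB, hB4, hS, hout⟩ := hA.exists_split hac hA4
      have hBac := hac.anti (within_mono hBA)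
      have hce := Finset.card_erase_of_mem hv
      rcases hout with rfl | ⟨p, hp, hpB, hvp, hout⟩
      · refine ⟨B.erase v, Finset.erase_subset _ _, hS, by omega, fun _ ↦ ?_⟩
        -- `3|B| ≤ 4(|B| - 1)` is an equality exactly when `|B| = 4`.
        rcases hB4.eq_or_lt with hB4 | hB4
        · refine .inr ⟨1, by omega, ?_⟩
          rcases hB.nonempty_iso_path_or_star hBac hB4.symm with ⟨⟨f⟩⟩ | ⟨⟨f⟩⟩
          · exact .path f
          · exact .star f
        · exact .inl (by omega)
      · have hss : A \ B ⊂ A :=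
          Finset.sdiff_ssubset hBA ⟨v, hv⟩
        obtain ⟨S, hSA, hS', hcard, heq⟩ := ih' _ hss
        have hconn : G.IsConnectedSet (A \ B) := hA.sdiff hp hpB fun x hx hxB y hy hxy ↦
          (hout y hy x hx hxB hxy.symm).2
        have hdisj : Disjoint S (B.erase v) :=
          Finset.disjoint_of_subset_left hSA
            (Finset.disjoint_of_subset_right (Finset.erase_subset _ _) Finset.sdiff_disjoint)
        have hcu := Finset.card_union_of_disjoint hdisj
        have hcs := Finset.card_sdiff_add_card_eq_card hBA
        refine ⟨S ∪ B.erase v, Finset.union_subset (hSA.trans Finset.sdiff_subset)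
          ((Finset.erase_subset _ _).trans hBA), hS'.union hS ?_, by omega, fun _ ↦ ?_⟩
        · intro x hx y hy hxy
          have hx := Finset.mem_sdiff.1 (hSA hx)
          have hy := Finset.mem_erase.1 hy
          exact hy.1 (hout y hy.2 x hx.1 hx.2 hxy.symm).1
        · rcases hB4.eq_or_lt with hB4 | hB4
          · rcases heq hconn with hlt | ⟨i, hi, hLZ⟩
            · exact .inl (by omega)
            · refine .inr ⟨i + 1, by omega, ?_⟩
              rcases hB.nonempty_iso_path_or_star hBac hB4.symm with ⟨⟨f⟩⟩ | ⟨⟨f⟩⟩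
              · obtain ⟨e⟩ := nonempty_iso_joinByEdge hBA hv hp hpB hvp hout f
                exact .addPath hLZ _ _ e
              · obtain ⟨e⟩ := nonempty_iso_joinByEdge hBA hv hp hpB hvp hout f
                exact .addStar hLZ _ _ e
          · exact .inl (by omega)
    · rcases A.eq_empty_or_nonempty with rfl | ⟨x, hx⟩
      · exact ⟨∅, subset_rfl, hasNoConnectedFour_of_card_lt (by simp), by simp,
          fun h ↦ (hA h).elim⟩
      have hKA : G.componentIn A x ⊆ A := componentIn_subset
      have hK := isConnectedSet_componentIn (G := G) hx
      have hne : G.componentIn A x ≠ A := fun h ↦ hA (h ▸ hK)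
      obtain ⟨S, hSK, hS, hSc, -⟩ := ih' _ (hKA.ssubset_of_ne hne)
      obtain ⟨T, hTK, hT, hTc, -⟩ := ih' _ (Finset.sdiff_ssubset hKA hK.1)
      have hdisj : Disjoint S T :=
        Finset.disjoint_of_subset_left hSK
          (Finset.disjoint_of_subset_right hTK Finset.disjoint_sdiff)
      have hcu := Finset.card_union_of_disjoint hdisj
      have hcs := Finset.card_sdiff_add_card_eq_card hKA
      refine ⟨S ∪ T, Finset.union_subset (hSK.trans hKA) (hTK.trans Finset.sdiff_subset),
        hS.union hT fun a ha b hb hab ↦ ?_, by omega, fun h ↦ (hA h).elim⟩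
      have hb := Finset.mem_sdiff.1 (hTK hb)
      exact hb.2 (mem_componentIn_of_adj (hSK ha) hb.1 hab)

end Forests

/-! ### Structure forced by equality in the lower bound -/

section Tight

variable {V : Type u} {G : SimpleGraph V} {A B K : Finset V} {a b u v x : V}

lemma OnCycle.mem_of_within (h : (G.within A).OnCycle v) : v ∈ A := by
  obtain ⟨w, hw, -⟩ := h
  exact hw.2.1

lemma Walk.IsCycle.onCycle {p : G.Walk u u} (hp : p.IsCycle) (hx : x ∈ p.support) :
    G.OnCycle x := onCycle_iff_exists_isCycle.2 ⟨u, p, hp, hx⟩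

lemma Walk.edges_subset_edgeSet_within (p : (G.within A).Walk a b)
    (h : ∀ x ∈ p.support, x ∈ B) : ∀ e ∈ p.edges, e ∈ (G.within B).edgeSet := by
  intro e he
  induction e using Sym2.ind with
  | _ x y =>
    have hxy : (G.within A).Adj x y := p.edges_subset_edgeSet he
    exact ⟨hxy.1, h _ (p.fst_mem_support_of_mem_edges he), h _ (p.snd_mem_support_of_mem_edges he)⟩

variable [DecidableEq V]

lemma Walk.reachable_of_mem_support (p : G.Walk a b) (hu : u ∈ p.support) (hv : v ∈ p.support) :
    G.Reachable u v :=
  (p.takeUntil u hu).reachable.symm.trans (p.takeUntil v hv).reachable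

variable [Fintype V]

lemma OnCycle.cycleSpaceDim_within_erase (h : (G.within A).OnCycle v) :
    (G.within (A.erase v)).cycleSpaceDim + 1 ≤ (G.within A).cycleSpaceDim :=
  h.cycleSpaceDim_lt (within_mono (Finset.erase_subset _ _)) fun w hw ↦ by
    simpa using hw.2.1

omit [Fintype V] in
lemma OnCycle.intCast_card_erase (h : (G.within A).OnCycle v) :
    ((A.erase v).card : ℤ) = A.card - 1 := by
  have := Finset.card_erase_add_one h.mem_of_within
  omega

-- Removing a vertex on a cycle does not decrease `|A| - ω`, so the forest bound carries over.
variable (G A) in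
lemma exists_hasNoConnectedFour_within : ∃ S ⊆ A, G.HasNoConnectedFour S ∧
    3 * ((A.card : ℤ) - (G.within A).cycleSpaceDim) ≤ 4 * S.card := by
  induction A using Finset.strongInduction with
  | H A ih =>
    by_cases hc : ∃ v, (G.within A).OnCycle v
    · obtain ⟨v, hv⟩ := hc
      obtain ⟨S, hSA, hS, hcard⟩ := ih _ (Finset.erase_ssubset hv.mem_of_within)
      have := hv.cycleSpaceDim_within_erase
      have := hv.intCast_card_erase
      exact ⟨S, hSA.trans (Finset.erase_subset _ _), hS, by omega⟩
    · have hac : (G.within A).IsAcyclic := isAcyclic_iff_forall_not_onCycle.2 (by simpa using hc)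
      obtain ⟨S, hSA, hS, hcard, -⟩ := hac.exists_hasNoConnectedFour
      exact ⟨S, hSA, hS, by rw [hac.cycleSpaceDim_eq_zero]; omega⟩

/-- The lower bound for the generalized independence number is attained on `A`. -/
def IsTight (G : SimpleGraph V) (A : Finset V) : Prop :=
  ∀ S ⊆ A, G.HasNoConnectedFour S →
    4 * (S.card : ℤ) ≤ 3 * ((A.card : ℤ) - (G.within A).cycleSpaceDim)

/-- A larger drop of `ω` would make the general lower bound on `A.erase v` exceed the maximum
allowed on `A`. -/
lemma IsTight.cycleSpaceDim_le (h : G.IsTight A) (hv : v ∈ A) :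
    (G.within A).cycleSpaceDim ≤ (G.within (A.erase v)).cycleSpaceDim + 1 := by
  obtain ⟨S, hSA, hS, hcard⟩ := exists_hasNoConnectedFour_within G (A.erase v)
  have := h S (hSA.trans (Finset.erase_subset _ _)) hS
  have := Finset.card_erase_add_one hv
  omega

lemma IsTight.erase (h : G.IsTight A) (hv : (G.within A).OnCycle v) : G.IsTight (A.erase v) := by
  intro S hSA hS
  have := h S (hSA.trans (Finset.erase_subset _ _)) hS
  have := hv.cycleSpaceDim_within_erase
  have := hv.intCast_card_erase
  omega

/-- If the edge `xv` of `q` were not on `p`, deleting it would lower `ω` by one and leave `p`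
intact. Deleting the rest of the edges at `x`, which still lies on `p`, would lower `ω` again, too
much for one vertex. -/
lemma IsTight.mem_edges_of_mem_support (h : G.IsTight A) {p : (G.within A).Walk a a}
    {q : (G.within A).Walk b b} (hp : p.IsCycle) (hq : q.IsCycle) (hx : x ∈ p.support)
    (hxv : s(x, v) ∈ q.edges) : s(x, v) ∈ p.edges := by
  by_contra hn
  have hbr := adj_and_reachable_delete_edges_iff_exists_cycle.2 ⟨b, q, hq, hxv⟩
  have hdel := cycleSpaceDim_deleteEdges_of_reachable hbr.1 hbr.2
  have hpe : ∀ e ∈ p.edges, e ∈ ((G.within A).deleteEdges {s(x, v)}).edgeSet := by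
    intro e he
    rw [edgeSet_deleteEdges]
    exact ⟨p.edges_subset_edgeSet he, fun h' ↦ hn (Set.mem_singleton_iff.1 h' ▸ he)⟩
  have hcyc := (hp.transfer hpe).onCycle (x := x) (by simpa using hx)
  have hno : ∀ w, ¬ (G.within (A.erase x)).Adj x w := fun w hw ↦ by simpa using hw.2.1
  have := hcyc.cycleSpaceDim_lt
    (le_deleteEdges_singleton (within_mono (Finset.erase_subset x A)) (hno v)) hno
  have := h.cycleSpaceDim_le (hp.onCycle hx).mem_of_within
  omega

/-- Starting at the common vertex and going around `q`, each edge lies on `p`, hence so does its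
next vertex. -/
lemma IsTight.edgeSet_subset_of_mem_support (h : G.IsTight A) {p : (G.within A).Walk a a}
    {q : (G.within A).Walk b b} (hp : p.IsCycle) (hq : q.IsCycle) (hx : x ∈ p.support)
    (hxq : x ∈ q.support) : q.edgeSet ⊆ p.edgeSet := by
  have key : ∀ {c d : V} (r : (G.within A).Walk c d), r.edges ⊆ q.edges → c ∈ p.support →
      r.edges ⊆ p.edges := by
    intro c d r
    induction r with
    | nil => simp
    | @cons c e d hce r ih =>
      intro hr hc
      rw [Walk.edges_cons, List.cons_subset] at hr ⊢
      have he := h.mem_edges_of_mem_support hp hq hc hr.1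
      exact ⟨he, ih hr.2 (p.snd_mem_support_of_mem_edges he)⟩
  intro e he
  exact key (q.rotate x hxq) (fun e he ↦ ((q.rotate_edges x hxq).mem_iff).1 he) hx
    (((q.rotate_edges x hxq).mem_iff).2 he)

/-- In a tight set, a connected set that meets no cycle and all of whose outer neighbours lie on
cycles induces a member of a Li–Zhou family. -/
lemma IsTight.liZhou (h : G.IsTight A) (hKA : K ⊆ A) (hK : G.IsConnectedSet K)
    (hKc : ∀ x ∈ K, ¬ (G.within A).OnCycle x)
    (hout : ∀ x ∈ K, ∀ y ∈ A, y ∉ K → G.Adj x y → (G.within A).OnCycle y) :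
    ∃ i, K.card = 4 * i ∧ LiZhou i (G.induce (K : Set V)) := by
  induction A using Finset.strongInduction with
  | H A ih =>
    have hmono : ∀ v, G.within (A.erase v) ≤ G.within A := fun v ↦
      within_mono (Finset.erase_subset _ _)
    have hKe : ∀ v, v ∉ K → K ⊆ A.erase v := fun v hv ↦ Finset.subset_erase.2 ⟨hKA, hv⟩
    by_cases hnb : ∃ k ∈ K, ∃ u ∈ A, u ∉ K ∧ G.Adj k u
    · obtain ⟨k, hk, u, hu, huK, hku⟩ := hnb
      have huc := hout k hk u hu huK hku
      -- Delete the outer neighbour `u`. Any other outer neighbour `u'` stays on a cycle: a cycle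
      -- `r` through `u'` avoids `K`, and if it contained `u`, the two edges into `K` would put `k`
      -- on a cycle.
      refine ih _ (Finset.erase_ssubset hu) (h.erase huc) (hKe u huK)
        (fun x hx hxc ↦ hKc x hx (hxc.mono (hmono u))) fun k' hk' u' hu' hu'K hku' ↦ ?_
      obtain ⟨hne, hu'A⟩ := Finset.mem_erase.1 hu'
      obtain ⟨c, r, hr, hu'r⟩ := onCycle_iff_exists_isCycle.1 (hout k' hk' u' hu'A hu'K hku')
      have hrK : ∀ x ∈ r.support, x ∈ A \ K := fun x hx ↦ Finset.mem_sdiff.2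
        ⟨(hr.onCycle hx).mem_of_within, fun hxK ↦ hKc x hxK (hr.onCycle hx)⟩
      have hur : u ∉ r.support := by
        intro hur
        have hreach := (r.transfer _ (r.edges_subset_edgeSet_within hrK)).reachable_of_mem_support
          (u := u) (v := u') (by simpa using hur) (by simpa using hu'r)
        exact hKc k hk (hK.onCycle_of_two_edges hKA hu huK hu'A hk hk' hku hku' (.inl hne.symm)
          hreach)
      have hre : ∀ x ∈ r.support, x ∈ A.erase u := fun x hx ↦ Finset.mem_erase.2
        ⟨fun hxu ↦ hur (hxu ▸ hx), (hr.onCycle hx).mem_of_within⟩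
      exact (hr.transfer (r.edges_subset_edgeSet_within hre)).onCycle (by simpa using hu'r)
    · push Not at hnb
      -- Now `K` has no outer neighbours. Once the remaining cycles are destroyed, a strict gain on
      -- `K` together with the forest bound outside `K` would contradict tightness.
      by_cases hc : ∃ v, (G.within A).OnCycle v
      · obtain ⟨v, hv⟩ := hc
        exact ih _ (Finset.erase_ssubset hv.mem_of_within) (h.erase hv)
          (hKe v fun hvK ↦ hKc v hvK hv) (fun x hx hxc ↦ hKc x hx (hxc.mono (hmono v)))
          fun x hx y hy hyK hxy ↦ (hnb x hx y (Finset.mem_of_mem_erase hy) hyK hxy).elim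
      · have hac : (G.within A).IsAcyclic :=
          isAcyclic_iff_forall_not_onCycle.2 (by simpa using hc)
        obtain ⟨S, hSK, hS, -, hcase⟩ :=
          (hac.anti (within_mono hKA)).exists_hasNoConnectedFour
        obtain ⟨T, hTK, hT, hTc, -⟩ :=
          (hac.anti (within_mono (Finset.sdiff_subset (t := K)))).exists_hasNoConnectedFour
        rcases hcase hK with hlt | hi
        · have hdisj : Disjoint S T :=
            Finset.disjoint_of_subset_left hSK
              (Finset.disjoint_of_subset_right hTK Finset.disjoint_sdiff)
          have hcu := Finset.card_union_of_disjoint hdisj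
          have hcs := Finset.card_sdiff_add_card_eq_card hKA
          have := h (S ∪ T) (Finset.union_subset (hSK.trans hKA) (hTK.trans Finset.sdiff_subset))
            (hS.union hT fun x hx y hy hxy ↦ ?_)
          · rw [hac.cycleSpaceDim_eq_zero] at this
            omega
          · have hy := Finset.mem_sdiff.1 (hTK hy)
            exact hnb x (hSK hx) y hy.1 hy.2 hxy
        · exact hi

/-- In a tight set, all cycle lengths are congruent to `1` modulo `4`. -/
lemma IsTight.card_support_mod_four (h : G.IsTight A) {p : (G.within A).Walk a a}
    (hp : p.IsCycle) : p.support.toFinset.card % 4 = 1 := by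
  induction A using Finset.strongInduction with
  | H A ih =>
    have hpA : ∀ x ∈ p.support, x ∈ A := fun x hx ↦ (hp.onCycle hx).mem_of_within
    -- Delete cycle vertices off `p` until every vertex on a cycle lies on `p`.
    by_cases hc : ∃ v, (G.within A).OnCycle v ∧ v ∉ p.support
    · obtain ⟨v, hv, hvp⟩ := hc
      have hpe : ∀ x ∈ p.support, x ∈ A.erase v := fun x hx ↦ Finset.mem_erase.2
        ⟨fun hxv ↦ hvp (hxv ▸ hx), hpA x hx⟩
      have := ih _ (Finset.erase_ssubset hv.mem_of_within) (h.erase hv)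
        (hp.transfer (p.edges_subset_edgeSet_within hpe))
      simpa using this
    · push Not at hc
      -- Any remaining cycle meets `p`, so it contains all edges of `p` and therefore passes through
      -- `a`.
      have hac : (G.within (A.erase a)).IsAcyclic := by
        intro c q hq
        have hle := within_mono (G := G) (Finset.erase_subset a A)
        have hq' := hq.mapLe hle
        have hcq : c ∈ (q.mapLe hle).support := Walk.start_mem_support _
        have hcp : c ∈ p.support := hc c (hq'.onCycle hcq)
        have hsub := h.edgeSet_subset_of_mem_support hq' hp hcq hcp
        obtain ⟨e, he, hae⟩ :=
          (Walk.mem_support_iff_exists_mem_edges_of_not_nil hp.not_nil).1 p.start_mem_support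
        have hq'' : a ∈ (q.mapLe hle).support :=
          (Walk.mem_support_iff_exists_mem_edges_of_not_nil hq'.not_nil).2
            ⟨e, Walk.mem_edgeSet.1 (hsub (Walk.mem_edgeSet.2 he)), hae⟩
        have haq : a ∈ q.support := by simpa [Walk.mapLe] using hq''
        simpa using (hq.onCycle haq).mem_of_within
      have ha := hp.onCycle p.start_mem_support
      -- The lower bound and tightness on the forest `A.erase a` give `4|S| = 3(|A| - 1)`.
      have h4A : (A.card : ℤ) % 4 = 1 := by
        obtain ⟨S, hSA, hS, hcard⟩ := exists_hasNoConnectedFour_within G (A.erase a)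
        have hle := h.erase ha S hSA hS
        have := ha.intCast_card_erase
        rw [hac.cycleSpaceDim_eq_zero] at hcard hle
        omega
      have hpA' : p.support.toFinset ⊆ A := fun x hx ↦ hpA x (by simpa using hx)
      -- Off `p` no vertex lies on a cycle, so each component there is a Li–Zhou tree, of order
      -- divisible by 4.
      have hZ : 4 ∣ (A \ p.support.toFinset).card := by
        refine dvd_card_of_dvd_card_componentIn (G := G) fun x hx ↦ ?_
        have hsub : G.componentIn (A \ p.support.toFinset) x ⊆ A \ p.support.toFinset :=
          componentIn_subset
        have hout : ∀ y ∈ G.componentIn (A \ p.support.toFinset) x, ∀ z ∈ A,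
            z ∉ G.componentIn (A \ p.support.toFinset) x → G.Adj y z →
              (G.within A).OnCycle z := by
          intro y hy z hz hzK hyz
          by_contra hzc
          refine hzK (mem_componentIn_of_adj hy (Finset.mem_sdiff.2 ⟨hz, fun hzp ↦ hzc ?_⟩) hyz)
          exact hp.onCycle (by simpa using hzp)
        obtain ⟨i, hi, -⟩ := h.liZhou (hsub.trans Finset.sdiff_subset)
          (isConnectedSet_componentIn hx)
          (fun y hy hyc ↦ (Finset.mem_sdiff.1 (hsub hy)).2 (by simpa using hc y hyc)) hout
        exact ⟨i, hi⟩
      have := Finset.card_sdiff_add_card_eq_card hpA'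
      omega

end Tight

/-! ### Upper bounds on Li–Zhou trees and on cycles -/

section UpperBounds

variable {V W : Type*} {G : SimpleGraph V} {H : SimpleGraph W} {S Z : Finset V}

lemma HasNoConnectedFour.of_hom (h : G.HasNoConnectedFour S) (f : H →g G)
    (hf : Function.Injective f) {T : Finset W} (hT : ∀ x ∈ T, f x ∈ S) :
    H.HasNoConnectedFour T := by
  intro B hB hBc hcard
  refine h (B.map ⟨f, hf⟩) ?_ ⟨hBc.1.map, ?_⟩ (by simpa using hcard)
  · intro y hy
    obtain ⟨x, hx, rfl⟩ := Finset.mem_map.1 hy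
    exact hT x (hB hx)
  · intro y hy z hz
    obtain ⟨a, ha, rfl⟩ := Finset.mem_map.1 hy
    obtain ⟨b, hb, rfl⟩ := Finset.mem_map.1 hz
    let φ : H.within B →g G.within (B.map ⟨f, hf⟩) :=
      ⟨f, fun {c d} hcd ↦ ⟨f.map_adj hcd.1, Finset.mem_map_of_mem ⟨f, hf⟩ hcd.2.1,
        Finset.mem_map_of_mem ⟨f, hf⟩ hcd.2.2⟩⟩
    exact (hBc.2 a ha b hb).map φ

lemma Connected.card_le_three {P : SimpleGraph (Fin 4)} (hP : P.Connected) {T : Finset (Fin 4)}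
    (hT : P.HasNoConnectedFour T) : T.card ≤ 3 := by
  by_contra! hc
  have hu : T = Finset.univ := (Finset.card_eq_iff_eq_univ T).1
    (le_antisymm (Finset.card_le_univ T) (by rw [Fintype.card_fin]; exact hc))
  subst hu
  refine hT _ subset_rfl ⟨Finset.univ_nonempty, fun x _ y _ ↦ ?_⟩ (by simp)
  rw [within_univ]
  exact hP.preconnected x y

lemma HasNoConnectedFour.card_le_of_iso (h : G.HasNoConnectedFour S) (e : G ≃g H) {n : ℕ}
    (hn : ∀ T : Finset W, H.HasNoConnectedFour T → T.card ≤ n) : S.card ≤ n := by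
  rw [← Finset.card_map e.toEquiv.toEmbedding]
  refine hn _ (h.of_hom e.symm.toHom e.symm.injective fun x hx ↦ ?_)
  obtain ⟨y, hy, rfl⟩ := Finset.mem_map.1 hx
  have : e.symm (e y) = y := e.symm_apply_apply y
  exact this.symm ▸ hy

/-- The joining edge plays no role: the restriction of `S` to either side inherits the property. -/
lemma card_le_add_of_joinByEdge {m n : ℕ} {v : V} {w : W}
    (hG : ∀ T : Finset V, G.HasNoConnectedFour T → T.card ≤ m)
    (hH : ∀ T : Finset W, H.HasNoConnectedFour T → T.card ≤ n) {S : Finset (V ⊕ W)}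
    (hS : (joinByEdge G H v w).HasNoConnectedFour S) : S.card ≤ m + n := by
  rw [← Finset.card_toLeft_add_card_toRight]
  refine add_le_add (hG _ ?_) (hH _ ?_)
  · exact hS.of_hom ⟨Sum.inl, fun {a b} hab ↦ .inl (sum_adj_inl.2 hab)⟩ Sum.inl_injective
      fun x hx ↦ Finset.mem_toLeft.1 hx
  · exact hS.of_hom ⟨Sum.inr, fun {a b} hab ↦ .inl (sum_adj_inr.2 hab)⟩ Sum.inr_injective
      fun x hx ↦ Finset.mem_toRight.1 hx

lemma LiZhou.card_le {V : Type u} {G : SimpleGraph V} {i : ℕ} (h : LiZhou i G) {S : Finset V}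
    (hS : G.HasNoConnectedFour S) : S.card ≤ 3 * i := by
  induction h with
  | path e => exact hS.card_le_of_iso e fun _ ↦ (pathGraph_connected 3).card_le_three
  | star e => exact hS.card_le_of_iso e fun _ ↦ (connected_starGraph 0).card_le_three
  | addPath _ v w e ih =>
    exact hS.card_le_of_iso e fun _ ↦
      card_le_add_of_joinByEdge (fun _ ↦ ih) fun _ ↦ (pathGraph_connected 3).card_le_three
  | addStar _ v w e ih =>
    exact hS.card_le_of_iso e fun _ ↦
      card_le_add_of_joinByEdge (fun _ ↦ ih) fun _ ↦ (connected_starGraph 0).card_le_three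

lemma LiZhou.of_iso {V V' : Type u} {G : SimpleGraph V} {G' : SimpleGraph V'} {i : ℕ}
    (h : LiZhou i G) (f : G' ≃g G) : LiZhou i G' := by
  cases h with
  | path e => exact .path (f.trans e)
  | star e => exact .star (f.trans e)
  | addPath hR v w e => exact .addPath hR v w (f.trans e)
  | addStar hR v w e => exact .addStar hR v w (f.trans e)

lemma nonempty_toSimpleGraph_iso {s : Set V} (hs : s = (Z : Set V)) (x : s) :
    Nonempty (((G.induce s).connectedComponentMk x).toSimpleGraph ≃g
      G.induce (G.componentIn Z x : Set V)) := by
  subst hs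
  let T := (G.induce (Z : Set V)).connectedComponentMk x
  have hT : ∀ y : (Z : Set V), y ∈ T.supp ↔ (y : V) ∈ G.componentIn Z x := by
    intro y
    rw [ConnectedComponent.mem_supp_iff, mem_componentIn, ConnectedComponent.eq,
      reachable_induce_iff, reachable_comm]
    exact (and_iff_right (Finset.mem_coe.1 y.2)).symm
  let f : T.supp → (G.componentIn Z x : Set V) := fun y ↦ ⟨y, (hT y).1 y.2⟩
  have hf : f.Bijective := by
    constructor
    · intro a b hab
      exact Subtype.ext (Subtype.ext
        (congrArg (fun z : (G.componentIn Z x : Set V) ↦ (z : V)) hab))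
    · rintro ⟨y, hy⟩
      exact ⟨⟨⟨y, componentIn_subset hy⟩, (hT _).2 hy⟩, rfl⟩
  exact ⟨⟨Equiv.ofBijective f hf, Iff.rfl⟩⟩

variable [DecidableEq V]

lemma HasNoConnectedFour.not_subset_of_path {a b c d : V} (h : G.HasNoConnectedFour S)
    (hab : G.Adj a b) (hbc : G.Adj b c) (hcd : G.Adj c d) (hac : a ≠ c) (had : a ≠ d)
    (hbd : b ≠ d) : ¬ {a, b, c, d} ⊆ S := by
  intro hsub
  refine h _ hsub ?_ (Finset.card_eq_of_equiv_fin ?_)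
  · have h1 : G.IsConnectedSet {c, d} := (isConnectedSet_singleton c).union_of_adj
      (isConnectedSet_singleton d) (Finset.mem_singleton_self c) (Finset.mem_singleton_self d) hcd
    have h2 : G.IsConnectedSet {b, c, d} := (isConnectedSet_singleton b).union_of_adj h1
      (Finset.mem_singleton_self b) (Finset.mem_insert_self c _) hbc
    exact (isConnectedSet_singleton a).union_of_adj h2 (Finset.mem_singleton_self a)
      (Finset.mem_insert_self b _) hab
  · refine Finset.equivFinOfCardEq ?_
    rw [Finset.card_insert_of_notMem, Finset.card_insert_of_notMem, Finset.card_pair hcd.ne]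
    · simp [hbc.ne, hbd]
    · simp [hab.ne, hac, had]

/-- Cut the path into `k` blocks of four consecutive vertices; `S` misses a vertex of each. -/
lemma HasNoConnectedFour.card_inter_image_le (h : G.HasNoConnectedFour S) {g : ℕ → V} {k : ℕ}
    (hg : Set.InjOn g (Set.Iio (4 * k))) (hadj : ∀ i, i + 1 < 4 * k → G.Adj (g i) (g (i + 1))) :
    (S ∩ (Finset.range (4 * k)).image g).card ≤ 3 * k := by
  induction k with
  | zero => simp
  | succ k ih =>
    have hne : ∀ i j, i < 4 * (k + 1) → j < 4 * (k + 1) → i ≠ j → g i ≠ g j :=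
      fun i j hi hj hij he ↦ hij (hg hi hj he)
    have ih := ih (hg.mono (Set.Iio_subset_Iio (by omega))) fun i hi ↦ hadj i (by omega)
    set F : Finset V := {g (4 * k), g (4 * k + 1), g (4 * k + 2), g (4 * k + 3)} with hF
    have hsub : S ∩ (Finset.range (4 * (k + 1))).image g ⊆
        (S ∩ (Finset.range (4 * k)).image g) ∪ (S ∩ F) := by
      rw [← Finset.inter_union_distrib_left]
      refine Finset.inter_subset_inter_left ?_
      intro x hx
      obtain ⟨i, hi, rfl⟩ := Finset.mem_image.1 hx
      rw [Finset.mem_range] at hi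
      rw [Finset.mem_union]
      by_cases hik : i < 4 * k
      · exact .inl (Finset.mem_image_of_mem g (Finset.mem_range.2 hik))
      · right
        obtain rfl | rfl | rfl | rfl :
          i = 4 * k ∨ i = 4 * k + 1 ∨ i = 4 * k + 2 ∨ i = 4 * k + 3 := by omega
        all_goals simp [hF]
    have hSF : (S ∩ F).card ≤ 3 := by
      have hnot : ¬ F ⊆ S := h.not_subset_of_path (hadj _ (by omega)) (hadj _ (by omega))
        (hadj _ (by omega)) (hne _ _ (by omega) (by omega) (by omega))
        (hne _ _ (by omega) (by omega) (by omega)) (hne _ _ (by omega) (by omega) (by omega))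
      have hlt : (S ∩ F).card < F.card := Finset.card_lt_card
        ⟨Finset.inter_subset_right, fun hs ↦ hnot (hs.trans Finset.inter_subset_left)⟩
      have : F.card ≤ 4 := Finset.card_le_four
      omega
    have := (Finset.card_le_card hsub).trans (Finset.card_union_le _ _)
    omega

lemma Walk.IsCycle.card_support_toFinset {u : V} {p : G.Walk u u} (hp : p.IsCycle) :
    p.support.toFinset.card = p.length := by
  have : p.support.toFinset = p.support.tail.toFinset := by
    ext x
    rw [List.mem_toFinset, List.mem_toFinset, p.mem_support_iff]
    refine ⟨fun h ↦ h.elim (fun h ↦ h ▸ p.end_mem_tail_support hp.not_nil) id, .inr⟩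
  rw [this, List.toFinset_card_of_nodup hp.support_nodup]
  simp

/-- `S` misses some vertex `v` of the cycle, and the other `4k` vertices form a path. The missed `v`
is what absorbs the extra `1`. -/
lemma HasNoConnectedFour.card_inter_support_le (h : G.HasNoConnectedFour S) {u : V}
    {p : G.Walk u u} (hp : p.IsCycle) {k : ℕ} (hk : p.support.toFinset.card = 4 * k + 1) :
    (S ∩ p.support.toFinset).card ≤ 3 * k := by
  have h3 := hp.three_le_length
  have hlen := hp.card_support_toFinset
  obtain ⟨v, hv, hvS⟩ : ∃ v ∈ p.support, v ∉ S := by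
    by_contra! hc
    have hne : ∀ i j, i ≤ 3 → j ≤ 3 → i ≠ j → p.getVert i ≠ p.getVert j := fun i j hi hj hij he ↦
      hij (hp.getVert_injOn' (by simp only [Set.mem_ofPred_eq]; omega)
        (by simp only [Set.mem_ofPred_eq]; omega) he)
    refine h.not_subset_of_path (p.adj_getVert_succ (i := 0) (by omega))
      (p.adj_getVert_succ (i := 1) (by omega)) (p.adj_getVert_succ (i := 2) (by omega))
      (hne _ _ (by omega) (by omega) (by omega)) (hne _ _ (by omega) (by omega) (by omega))
      (hne _ _ (by omega) (by omega) (by omega)) fun x hx ↦ hc x ?_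
    simp only [Finset.mem_insert, Finset.mem_singleton] at hx
    rcases hx with rfl | rfl | rfl | rfl <;> exact p.getVert_mem_support _
  set q := p.rotate v hv with hq
  have hqc : q.IsCycle := hp.rotate hv
  have hqs : ∀ x, x ∈ p.support → x ∈ q.support := fun x hx ↦ by
    rw [← Walk.mem_verts_toSubgraph] at hx ⊢
    rwa [hq, Walk.toSubgraph_rotate]
  have hql : q.length = 4 * k + 1 := by
    rw [hq, Walk.length_rotate]
    omega
  refine le_trans (Finset.card_le_card ?_)
    -- The shift by one skips the base point `v`, so indices below `4k` run over the rest of the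
    -- cycle once.
    (h.card_inter_image_le (g := fun i ↦ q.getVert (i + 1)) (k := k) ?_ ?_)
  · intro x hx
    rw [Finset.mem_inter, List.mem_toFinset] at hx
    refine Finset.mem_inter.2 ⟨hx.1, ?_⟩
    obtain ⟨n, rfl, hn⟩ := Walk.mem_support_iff_exists_getVert.1 (hqs x hx.2)
    have h0 : n ≠ 0 := by
      rintro rfl
      exact hvS (by simpa using hx.1)
    have hl : n ≠ q.length := by
      rintro rfl
      exact hvS (by simpa using hx.1)
    refine Finset.mem_image.2 ⟨n - 1, Finset.mem_range.2 (by omega), ?_⟩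
    simp only [Nat.sub_add_cancel (Nat.one_le_iff_ne_zero.2 h0)]
  · intro i hi j hj hij
    rw [Set.mem_Iio] at hi hj
    have := hqc.getVert_injOn (by simp only [Set.mem_ofPred_eq]; omega)
      (by simp only [Set.mem_ofPred_eq]; omega) hij
    omega
  · intro i hi
    exact q.adj_getVert_succ (by omega)

lemma card_inter_le_of_componentIn
    (h : ∀ x ∈ Z, 4 * (S ∩ G.componentIn Z x).card ≤ 3 * (G.componentIn Z x).card) :
    4 * (S ∩ Z).card ≤ 3 * Z.card := by
  have hfib : ∀ x, Z.filter (fun y ↦ G.componentIn Z y = G.componentIn Z x) ⊆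
      G.componentIn Z x := fun x y hy ↦
    (Finset.mem_filter.1 hy).2 ▸ self_mem_componentIn (Finset.mem_filter.1 hy).1
  have hfib' : ∀ x, G.componentIn Z x ⊆
      Z.filter (fun y ↦ G.componentIn Z y = G.componentIn Z x) := fun x y hy ↦
    Finset.mem_filter.2 ⟨componentIn_subset hy, componentIn_eq_of_mem hy⟩
  rw [Finset.card_eq_sum_card_image (G.componentIn Z) Z,
    Finset.card_eq_sum_card_fiberwise (f := G.componentIn Z) (t := Z.image (G.componentIn Z))
      (s := S ∩ Z) (fun x hx ↦ Finset.mem_image_of_mem _ (Finset.mem_inter.1 hx).2),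
    Finset.mul_sum, Finset.mul_sum]
  refine Finset.sum_le_sum fun B hB ↦ ?_
  obtain ⟨x, hx, rfl⟩ := Finset.mem_image.1 hB
  refine le_trans ?_ ((h x hx).trans (Nat.mul_le_mul_left _ (Finset.card_le_card (hfib' x))))
  refine Nat.mul_le_mul_left _ (Finset.card_le_card fun y hy ↦ ?_)
  rw [Finset.mem_filter, Finset.mem_inter] at hy
  exact Finset.mem_inter.2 ⟨hy.1.1, hfib x (Finset.mem_filter.2 ⟨hy.1.2, hy.2⟩)⟩

end UpperBounds

/-! ### Assembling the bound and the equality case -/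

section Extremal

variable {V : Type*} {G : SimpleGraph V} {v : V}

lemma onCycle_iff_exists_isCycleSubgraph :
    G.OnCycle v ↔ ∃ C : G.Subgraph, G.IsCycleSubgraph C ∧ v ∈ C.verts := by
  rw [onCycle_iff_exists_isCycle]
  constructor
  · rintro ⟨u, p, hp, hv⟩
    exact ⟨p.toSubgraph, ⟨u, p, hp, rfl⟩, p.mem_verts_toSubgraph.2 hv⟩
  · rintro ⟨C, ⟨u, p, hp, rfl⟩, hv⟩
    exact ⟨u, p, hp, p.mem_verts_toSubgraph.1 hv⟩

lemma image_edgeSet_isCycleSubgraph :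
    Subgraph.edgeSet '' {C : G.Subgraph | G.IsCycleSubgraph C} = G.cycleEdgeSets := by
  ext E
  constructor
  · rintro ⟨C, ⟨u, p, hp, rfl⟩, rfl⟩
    exact ⟨u, p, hp, p.edgeSet_toSubgraph⟩
  · rintro ⟨u, p, hp, rfl⟩
    exact ⟨p.toSubgraph, ⟨u, p, hp, rfl⟩, p.edgeSet_toSubgraph⟩

open scoped Classical in
/-- The vertices of `G` that lie on no cycle. -/
noncomputable def acyclicVerts [Fintype V] (G : SimpleGraph V) : Finset V :=
  Finset.univ.filter fun v ↦ ¬ G.OnCycle v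

variable [Fintype V]

lemma mem_acyclicVerts : v ∈ G.acyclicVerts ↔ ¬ G.OnCycle v := by
  simp [acyclicVerts]

lemma setOf_forall_notMem_verts_eq :
    {v : V | ∀ C : G.Subgraph, G.IsCycleSubgraph C → v ∉ C.verts} = (G.acyclicVerts : Set V) := by
  ext v
  rw [Finset.mem_coe, mem_acyclicVerts, onCycle_iff_exists_isCycleSubgraph]
  simp

/-- Needed because `sSup` of an unbounded set of naturals is `0`. -/
lemma bddAbove_card_isGenIndepSet (k : ℕ) :
    BddAbove {m | ∃ S : Finset V, G.IsGenIndepSet k S ∧ S.card = m} :=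
  ⟨Fintype.card V, by rintro m ⟨S, -, rfl⟩; exact S.card_le_univ⟩

lemma HasNoConnectedFour.card_le_genIndepNum {S : Finset V} (h : G.HasNoConnectedFour S) :
    S.card ≤ G.genIndepNum 4 :=
  le_csSup (bddAbove_card_isGenIndepSet 4) ⟨S, isGenIndepSet_four_iff.2 h, rfl⟩

variable (G) in
lemma exists_card_eq_genIndepNum : ∃ S : Finset V, G.HasNoConnectedFour S ∧
    S.card = G.genIndepNum 4 := by
  obtain ⟨S, hS, hcard⟩ := Nat.sSup_mem (s := {m | ∃ S : Finset V, G.IsGenIndepSet 4 S ∧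
    S.card = m}) ⟨0, ∅, isGenIndepSet_four_iff.2 (hasNoConnectedFour_of_card_lt (by simp)), rfl⟩
    (bddAbove_card_isGenIndepSet 4)
  exact ⟨S, isGenIndepSet_four_iff.1 hS, hcard⟩

variable (G) in
lemma le_genIndepNum_four :
    3 * ((Fintype.card V : ℤ) - G.cycleSpaceDim) ≤ 4 * G.genIndepNum 4 := by
  classical
  obtain ⟨S, -, hS, hcard⟩ := exists_hasNoConnectedFour_within G Finset.univ
  rw [within_univ, Finset.card_univ] at hcard
  have := hS.card_le_genIndepNum
  omega

lemma isTight_univ (h : 4 * (G.genIndepNum 4 : ℤ) = 3 * (Fintype.card V - G.cycleSpaceDim)) :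
    G.IsTight Finset.univ := by
  intro S _ hS
  rw [within_univ, Finset.card_univ]
  have := hS.card_le_genIndepNum
  omega

omit [Fintype V] in
lemma ncard_verts_toSubgraph [DecidableEq V] {u w : V} (p : G.Walk u w) :
    p.toSubgraph.verts.ncard = p.support.toFinset.card := by
  rw [← Set.ncard_coe_finset]
  congr 1
  ext; simp

lemma IsTight.disjoint_verts (h : G.IsTight Finset.univ) {C D : G.Subgraph}
    (hC : G.IsCycleSubgraph C) (hD : G.IsCycleSubgraph D) (hne : C ≠ D) :
    Disjoint C.verts D.verts := by
  classical
  obtain ⟨u, p, hp, rfl⟩ := hC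
  obtain ⟨w, q, hq, rfl⟩ := hD
  by_contra hdis
  obtain ⟨x, hxp, hxq⟩ := Set.not_disjoint_iff.1 hdis
  rw [Walk.mem_verts_toSubgraph] at hxp hxq
  have hle : G ≤ G.within Finset.univ := within_univ.ge
  have hxp' : x ∈ (p.mapLe hle).support := by simpa [Walk.mapLe] using hxp
  have hxq' : x ∈ (q.mapLe hle).support := by simpa [Walk.mapLe] using hxq
  have h1 := h.edgeSet_subset_of_mem_support (hp.mapLe hle) (hq.mapLe hle) hxp' hxq'
  have h2 := h.edgeSet_subset_of_mem_support (hq.mapLe hle) (hp.mapLe hle) hxq' hxp'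
  have he : ∀ {a b : V} (r : G.Walk a b), (r.mapLe hle).edgeSet = r.edgeSet := by
    intro a b r
    ext; simp [Walk.mapLe]
  rw [he, he] at h1 h2
  -- The subgraph of a non-nil walk is determined by its edges.
  refine hne (le_antisymm ((Walk.toSubgraph_le_iff hp.not_nil).2 ?_)
    ((Walk.toSubgraph_le_iff hq.not_nil).2 ?_))
  · rwa [Walk.edgeSet_toSubgraph]
  · rwa [Walk.edgeSet_toSubgraph]

lemma IsTight.exists_ncard_verts (h : G.IsTight Finset.univ) {C : G.Subgraph}
    (hC : G.IsCycleSubgraph C) : ∃ k : ℕ, C.verts.ncard = 4 * k + 1 := by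
  classical
  obtain ⟨u, p, hp, rfl⟩ := hC
  have hle : G ≤ G.within Finset.univ := within_univ.ge
  have := h.card_support_mod_four (hp.mapLe hle)
  rw [ncard_verts_toSubgraph]
  have hs : (p.mapLe hle).support = p.support := by simp [Walk.mapLe]
  rw [hs] at this
  exact ⟨p.support.toFinset.card / 4, by omega⟩

lemma IsTight.liZhou_component (h : G.IsTight Finset.univ)
    (T : G.deleteCycleVerts.ConnectedComponent) :
    Nat.card T.supp ≡ 0 [MOD 4] ∧ LiZhou (Nat.card T.supp / 4) T.toSimpleGraph := by
  classical
  induction T using ConnectedComponent.ind with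
  | h x =>
    obtain ⟨e⟩ := nonempty_toSimpleGraph_iso (G := G) setOf_forall_notMem_verts_eq x
    have hx : (x : V) ∈ G.acyclicVerts := by
      rw [← Finset.mem_coe, ← setOf_forall_notMem_verts_eq]
      exact x.2
    obtain ⟨i, hi, hLZ⟩ := h.liZhou (Finset.subset_univ _) (isConnectedSet_componentIn hx)
      (fun y hy ↦ by
        rw [within_univ]
        exact mem_acyclicVerts.1 (componentIn_subset hy))
      (fun y hy z _ hzK hyz ↦ by
        rw [within_univ]
        by_contra hz
        exact hzK (mem_componentIn_of_adj hy (mem_acyclicVerts.2 hz) hyz))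
    have hcard : Nat.card (G.deleteCycleVerts.connectedComponentMk x).supp = 4 * i := by
      rw [← hi, ← Nat.card_eq_finsetCard]
      exact Nat.card_congr e.toEquiv
    rw [hcard]
    refine ⟨(Nat.modEq_zero_iff_dvd).2 ⟨i, rfl⟩, ?_⟩
    rw [Nat.mul_div_cancel_left i (by norm_num)]
    exact hLZ.of_iso e

lemma genIndepNum_four_le
    (hdis : ∀ C D : G.Subgraph, G.IsCycleSubgraph C → G.IsCycleSubgraph D → C ≠ D →
      Disjoint C.verts D.verts)
    (hlen : ∀ C : G.Subgraph, G.IsCycleSubgraph C → ∃ k : ℕ, C.verts.ncard = 4 * k + 1)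
    (hT : ∀ T : G.deleteCycleVerts.ConnectedComponent, Nat.card T.supp ≡ 0 [MOD 4] ∧
      LiZhou (Nat.card T.supp / 4) T.toSimpleGraph) :
    4 * (G.genIndepNum 4 : ℤ) ≤ 3 * (Fintype.card V - G.cycleSpaceDim) := by
  classical
  obtain ⟨S, hS, hcard⟩ := exists_card_eq_genIndepNum G
  rw [← hcard]
  let cycles : Finset G.Subgraph := Finset.univ.filter G.IsCycleSubgraph
  have hcyc : G.cycleSpaceDim ≤ cycles.card := by
    refine cycleSpaceDim_le_ncard_cycleEdgeSets.trans ?_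
    rw [← image_edgeSet_isCycleSubgraph, ← Set.ncard_coe_finset]
    have : {C : G.Subgraph | G.IsCycleSubgraph C} = (cycles : Set G.Subgraph) := by
      ext; simp [cycles]
    rw [this]
    exact Nat.cast_le.2 (Set.ncard_image_le (Set.toFinite _))
  have hunion : Finset.univ \ G.acyclicVerts = cycles.biUnion fun C ↦ C.verts.toFinset := by
    ext v
    simp [mem_acyclicVerts, onCycle_iff_exists_isCycleSubgraph, cycles]
  have hdis' : (cycles : Set G.Subgraph).PairwiseDisjoint fun C ↦ C.verts.toFinset := by
    intro C hC D hD hne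
    simp only [cycles, Finset.coe_filter, Finset.mem_univ, true_and, Set.mem_ofPred_eq] at hC hD
    exact Set.disjoint_toFinset.2 (hdis C D hC hD hne)
  -- Each cycle of order `4k + 1` contributes `4 * 3k + 3 = 3(4k + 1)`; disjointness allows
  -- summation.
  have hcycles : 4 * (S ∩ (Finset.univ \ G.acyclicVerts)).card + 3 * cycles.card ≤
      3 * (Finset.univ \ G.acyclicVerts).card := by
    rw [hunion, Finset.inter_biUnion, Finset.card_biUnion hdis', Finset.card_biUnion
      (fun C hC D hD hne ↦ (hdis' hC hD hne).mono Finset.inter_subset_right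
        Finset.inter_subset_right), Finset.mul_sum, Finset.mul_sum, mul_comm 3 cycles.card,
      ← smul_eq_mul cycles.card, ← Finset.sum_const, ← Finset.sum_add_distrib]
    refine Finset.sum_le_sum fun C hC ↦ ?_
    have hC : G.IsCycleSubgraph C := by simpa [cycles] using hC
    obtain ⟨k, hk⟩ := hlen C hC
    obtain ⟨u, p, hp, rfl⟩ := hC
    have hv : p.toSubgraph.verts.toFinset = p.support.toFinset := by ext; simp
    rw [ncard_verts_toSubgraph] at hk
    rw [hv, hk]
    have := hS.card_inter_support_le hp hk
    omega
  have hforest : 4 * (S ∩ G.acyclicVerts).card ≤ 3 * G.acyclicVerts.card := by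
    refine card_inter_le_of_componentIn (G := G) fun x hx ↦ ?_
    have hx' : x ∈ {v : V | ∀ C : G.Subgraph, G.IsCycleSubgraph C → v ∉ C.verts} := by
      rw [setOf_forall_notMem_verts_eq]
      exact hx
    obtain ⟨e⟩ := nonempty_toSimpleGraph_iso (G := G) setOf_forall_notMem_verts_eq ⟨x, hx'⟩
    obtain ⟨hmod, hLZ⟩ := hT (G.deleteCycleVerts.connectedComponentMk ⟨x, hx'⟩)
    have hK : Nat.card (G.deleteCycleVerts.connectedComponentMk ⟨x, hx'⟩).supp =
        (G.componentIn G.acyclicVerts x).card := by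
      rw [← Nat.card_eq_finsetCard]
      exact Nat.card_congr e.toEquiv
    rw [hK] at hmod hLZ
    have hLZ' := hLZ.of_iso e.symm
    have hle := hLZ'.card_le
      (S := S.subtype (· ∈ (G.componentIn G.acyclicVerts x : Set V)))
      (hS.of_hom (Embedding.induce _).toHom Subtype.val_injective
        fun y hy ↦ Finset.mem_subtype.1 hy)
    rw [Finset.card_subtype] at hle
    have hfil : S.filter (· ∈ (G.componentIn G.acyclicVerts x : Set V)) =
        S ∩ G.componentIn G.acyclicVerts x := by
      ext; simp
    rw [hfil] at hle
    have := (Nat.modEq_zero_iff_dvd).1 hmod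
    omega
  have h1 := Finset.card_sdiff_add_card_eq_card (Finset.subset_univ G.acyclicVerts)
  have h2 : (S ∩ (Finset.univ \ G.acyclicVerts)).card + (S ∩ G.acyclicVerts).card = S.card := by
    rw [← Finset.card_union_of_disjoint, ← Finset.inter_union_distrib_left,
      Finset.sdiff_union_of_subset (Finset.subset_univ _), Finset.inter_univ]
    · exact Finset.sdiff_disjoint.mono Finset.inter_subset_right Finset.inter_subset_right
  rw [Finset.card_univ] at h1
  omega

end Extremal

end SimpleGraph

theorem theorem1p4 {V : Type*} [Fintype V] (G : SimpleGraph V) :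
    (3 / 4 : ℝ) * ((Fintype.card V : ℝ) - (G.cycleSpaceDim : ℝ)) ≤ (G.genIndepNum 4 : ℝ) ∧
    ((G.genIndepNum 4 : ℝ) = (3 / 4 : ℝ) * ((Fintype.card V : ℝ) - (G.cycleSpaceDim : ℝ)) ↔
      (∀ C D : G.Subgraph, G.IsCycleSubgraph C → G.IsCycleSubgraph D → C ≠ D →
        Disjoint C.verts D.verts) ∧
      (∀ C : G.Subgraph, G.IsCycleSubgraph C → ∃ k : ℕ, C.verts.ncard = 4 * k + 1) ∧
      (∀ T : G.deleteCycleVerts.ConnectedComponent,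
        Nat.card T.supp ≡ 0 [MOD 4] ∧
          SimpleGraph.LiZhou (Nat.card T.supp / 4) T.toSimpleGraph)) := by
  have hle := SimpleGraph.le_genIndepNum_four G
  have hle' : 3 * ((Fintype.card V : ℝ) - (G.cycleSpaceDim : ℝ)) ≤ 4 * (G.genIndepNum 4 : ℝ) := by
    exact_mod_cast hle
  refine ⟨by linarith, fun h ↦ ?_, fun ⟨h1, h2, h3⟩ ↦ ?_⟩
  · have h' : 4 * (G.genIndepNum 4 : ℝ) = 3 * ((Fintype.card V : ℝ) - (G.cycleSpaceDim : ℝ)) := by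
      linarith
    have ht := SimpleGraph.isTight_univ (G := G) (by exact_mod_cast h')
    exact ⟨fun C D hC hD hne ↦ ht.disjoint_verts hC hD hne, fun C hC ↦ ht.exists_ncard_verts hC,
      ht.liZhou_component⟩
  · have h := SimpleGraph.genIndepNum_four_le h1 h2 h3
    have h' : 4 * (G.genIndepNum 4 : ℝ) ≤ 3 * ((Fintype.card V : ℝ) - (G.cycleSpaceDim : ℝ)) := by
      exact_mod_cast h
    linarith
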